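/- Let $\mathbb T^3$ be the three-dimensional torus, identified with the cube $(-\pi,\pi]^3$ carrying Lebesgue measure, and let $\gamma\in\mathbb R$, $\mu>0$. For $k,p\in\mathbb T^3$ put $$\varepsilon(k)=\sum_{i=1}^3(1-\cos k_i),\qquad w_1(k)=\varepsilon(k)+\gamma,\qquad w_2(k,p)=\varepsilon(k)+\varepsilon\bigl(\tfrac12(k+p)\bigr)+\varepsilon(p),$$ where $\tfrac12(k+p)$ is computed with the representatives in $(-\pi,\pi]^3$. Let $L_2^{\rm s}((\mathbb T^3)^2)$ be the space of symmetric functions in $L_2((\mathbb T^3)^2)$. Consider the bounded self-adjoint operator $$\mathcal A_\mu=\begin{pmatrix}A_{11}&\mu A_{12}\\ \mu A_{12}^*&A_{22}\end{pmatrix}\quad\text{in } L_2(\mathbb T^3)\oplus L_2^{\rm s}((\mathbb T^3)^2),$$ where $(A_{11}f_1)(k)=w_1(k)f_1(k)$, $(A_{12}f_2)(k)=\int_{\mathbb T^3}f_2(k,s)\,ds$ and $(A_{22}f_2)(k,p)=w_2(k,p)f_2(k,p)$. For $k\in\mathbb T^3$ consider the generalized Friedrichs model $$\mathcal A_\mu(k)=\begin{pmatrix}A_{00}(k)&\frac{\mu}{\sqrt2}A_{01}\\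 \frac{\mu}{\sqrt2}A_{01}^*&A_{11}(k)\end{pmatrix}\quad\text{in } \mathbb C\oplus L_2(\mathbb T^3),$$ where $A_{00}(k)f_0=w_1(k)f_0$, $A_{01}f_1=\int_{\mathbb T^3}f_1(t)\,dt$ and $(A_{11}(k)f_1)(p)=w_2(k,p)f_1(p)$. The discrete spectrum $\sigma_{\rm disc}$ of a bounded self-adjoint operator is the set of isolated points of its spectrum that are eigenvalues of finite multiplicity, and the essential spectrum $\sigma_{\rm ess}$ is the rest of the spectrum. Let $$m=\min_{k,p\in\mathbb T^3}w_2(k,p),\qquad M=\max_{k,p\in\mathbb T^3}w_2(k,p),\qquad \Lambda_\mu=\bigcup_{k\in\mathbb T^3}\sigma_{\rm disc}(\mathcal A_\mu(k)),\qquad \Sigma_\mu=[m;M]\cup\Lambda_\mu.$$ Then $\sigma_{\rm ess}(\mathcal A_\mu)=\Sigma_\mu$. Moreover, $\Sigma_\mu$ is a union of at most three bounded closed intervals $[a;b]$ with $a<b$. -/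

import Mathlib

open MeasureTheory Set
open scoped ENNReal

noncomputable section

namespace LatticeModel

/-! ### Spectra of bounded operators on a complex Hilbert space -/

section Spectra

variable {E : Type*} [NormedAddCommGroup E] [NormedSpace ℂ E]

/-- The discrete spectrum of a (self-adjoint) bounded operator: the isolated points of the
spectrum that are eigenvalues of finite multiplicity. -/
def discreteSpectrum (T : E →L[ℂ] E) : Set ℂ :=
  {z | z ∈ spectrum ℂ T ∧
    (∃ r > 0, Metric.ball z r ∩ spectrum ℂ T = {z}) ∧
    Module.End.HasEigenvalue (T : E →ₗ[ℂ] E) z ∧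
    FiniteDimensional ℂ (Module.End.eigenspace (T : E →ₗ[ℂ] E) z)}

/-- The essential spectrum of a (self-adjoint) bounded operator: the complement of the discrete
spectrum in the spectrum. -/
def essentialSpectrum (T : E →L[ℂ] E) : Set ℂ :=
  spectrum ℂ T \ discreteSpectrum T

end Spectra

/-! ### Block operator matrices -/

/-- The `2 × 2` block operator matrix `(A B; C D)` on the Hilbert space direct sum `E ⊕ F`. -/
def blockMatrix {E F : Type*} [NormedAddCommGroup E] [InnerProductSpace ℂ E]
    [NormedAddCommGroup F] [InnerProductSpace ℂ F]
    (A : E →L[ℂ] E) (B : F →L[ℂ] E) (C : E →L[ℂ] F) (D : F →L[ℂ] F) :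
    WithLp 2 (E × F) →L[ℂ] WithLp 2 (E × F) :=
  ((WithLp.prodContinuousLinearEquiv 2 ℂ E F).symm : E × F →L[ℂ] WithLp 2 (E × F)) ∘L
    ((A.coprod B).prod (C.coprod D)) ∘L
    ((WithLp.prodContinuousLinearEquiv 2 ℂ E F) : WithLp 2 (E × F) →L[ℂ] E × F)

theorem blockMatrix_apply {E F : Type*} [NormedAddCommGroup E] [InnerProductSpace ℂ E]
    [NormedAddCommGroup F] [InnerProductSpace ℂ F]
    (A : E →L[ℂ] E) (B : F →L[ℂ] E) (C : E →L[ℂ] F) (D : F →L[ℂ] F) (x : E) (y : F) :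
    blockMatrix A B C D (WithLp.toLp 2 (x, y)) =
      WithLp.toLp 2 (A x + B y, C x + D y) := rfl

/-! ### Multiplication operators -/

section Mul

variable {α : Type*} [MeasurableSpace α]

theorem memLp_mul (ν : Measure α) (w : α → ℝ) (hw : Measurable w)
    (hb : ∃ C : ℝ, ∀ x, |w x| ≤ C) (f : Lp ℂ 2 ν) :
    MemLp (fun x => (w x : ℂ) * f x) 2 ν := by
  obtain ⟨C, hC⟩ := hb
  refine MemLp.of_le_mul (c := C) (Lp.memLp f) ?_ (Filter.Eventually.of_forall fun x => ?_)
  · exact (Complex.measurable_ofReal.comp hw).aestronglyMeasurable.mul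
      (Lp.aestronglyMeasurable f)
  · rw [norm_mul, Complex.norm_real, Real.norm_eq_abs]
    exact mul_le_mul_of_nonneg_right (hC x) (norm_nonneg _)

/-- The operator of multiplication by a bounded measurable real function `w` in `L²(ν)`. -/
def mulOp (ν : Measure α) (w : α → ℝ) (hw : Measurable w)
    (hb : ∃ C : ℝ, ∀ x, |w x| ≤ C) : Lp ℂ 2 ν →L[ℂ] Lp ℂ 2 ν :=
  LinearMap.mkContinuousOfExistsBound
    { toFun := fun f => (memLp_mul ν w hw hb f).toLp _
      map_add' := fun f g => by
        apply Lp.ext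
        filter_upwards [(memLp_mul ν w hw hb (f + g)).coeFn_toLp,
          (memLp_mul ν w hw hb f).coeFn_toLp, (memLp_mul ν w hw hb g).coeFn_toLp,
          Lp.coeFn_add f g, Lp.coeFn_add ((memLp_mul ν w hw hb f).toLp _)
            ((memLp_mul ν w hw hb g).toLp _)] with x h1 h2 h3 h4 h5
        rw [h1, h5, Pi.add_apply, h2, h3, h4, Pi.add_apply, mul_add]
      map_smul' := fun c f => by
        apply Lp.ext
        filter_upwards [(memLp_mul ν w hw hb (c • f)).coeFn_toLp,
          (memLp_mul ν w hw hb f).coeFn_toLp,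
          Lp.coeFn_smul c f, Lp.coeFn_smul c ((memLp_mul ν w hw hb f).toLp _)]
          with x h1 h2 h3 h4
        rw [h1, RingHom.id_apply, h4, Pi.smul_apply, h2, h3, Pi.smul_apply, smul_eq_mul,
          smul_eq_mul, mul_left_comm] }
    (by
      obtain ⟨C, hC⟩ := id hb
      refine ⟨C, fun f => Lp.norm_le_mul_norm_of_ae_le_mul ?_⟩
      filter_upwards [(memLp_mul ν w hw hb f).coeFn_toLp] with x hx
      change ‖((memLp_mul ν w hw hb f).toLp _ : α → ℂ) x‖ ≤ _
      rw [hx, norm_mul, Complex.norm_real, Real.norm_eq_abs]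
      exact mul_le_mul_of_nonneg_right (hC x) (norm_nonneg _))

theorem coeFn_mulOp (ν : Measure α) (w : α → ℝ) (hw : Measurable w)
    (hb : ∃ C : ℝ, ∀ x, |w x| ≤ C) (f : Lp ℂ 2 ν) :
    mulOp ν w hw hb f =ᵐ[ν] fun x => (w x : ℂ) * f x :=
  (memLp_mul ν w hw hb f).coeFn_toLp

end Mul

/-! ### The torus and the one- and two-particle spaces -/

/-- The cube `(-π, π]³`; its points are the points of the three-dimensional torus. -/
def torus : Set (Fin 3 → ℝ) := {k | ∀ i, k i ∈ Ioc (-Real.pi) Real.pi}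

/-- The Haar measure of the torus, i.e. the Lebesgue measure on the cube `(-π, π]³`. -/
def torusMeasure : Measure (Fin 3 → ℝ) := volume.restrict torus

instance : IsFiniteMeasure torusMeasure := by
  refine ⟨?_⟩
  have h : torus ⊆ Icc (fun _ => -Real.pi) (fun _ => Real.pi) :=
    fun k hk => ⟨fun i => (hk i).1.le, fun i => (hk i).2⟩
  rw [torusMeasure, Measure.restrict_apply_univ]
  exact (measure_mono h).trans_lt isCompact_Icc.measure_lt_top

/-- The one-particle space `L₂(T³)`. -/
abbrev H1 : Type := Lp ℂ 2 torusMeasure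

/-- The space `L₂((T³)²)`. -/
abbrev L2Pair : Type := Lp ℂ 2 (torusMeasure.prod torusMeasure)

/-- The subspace `L₂ˢ((T³)²)` of symmetric functions in `L₂((T³)²)`. -/
def symmetricSubspace : Submodule ℂ L2Pair where
  carrier := {f | ∀ᵐ x ∂(torusMeasure.prod torusMeasure), f (x.2, x.1) = f x}
  zero_mem' := by
    have h := Lp.coeFn_zero ℂ 2 (torusMeasure.prod torusMeasure)
    filter_upwards [h, (Measure.measurePreserving_swap
      (μ := torusMeasure) (ν := torusMeasure)).quasiMeasurePreserving.ae h] with x h1 h2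
    exact h2.trans h1.symm
  add_mem' := fun {f g} hf hg => by
    have h := Lp.coeFn_add f g
    change ∀ᵐ x ∂(torusMeasure.prod torusMeasure), (f + g : L2Pair) (x.2, x.1) = (f + g : L2Pair) x
    filter_upwards [h, (Measure.measurePreserving_swap
      (μ := torusMeasure) (ν := torusMeasure)).quasiMeasurePreserving.ae h, hf, hg]
      with x h1 h2 h3 h4
    have h2' : (f + g : L2Pair) (x.2, x.1) = f (x.2, x.1) + g (x.2, x.1) := h2
    rw [h2', h1, h3, h4, Pi.add_apply]
  smul_mem' := fun c f hf => by
    have h := Lp.coeFn_smul c f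
    change ∀ᵐ x ∂(torusMeasure.prod torusMeasure), (c • f : L2Pair) (x.2, x.1) = (c • f : L2Pair) x
    filter_upwards [h, (Measure.measurePreserving_swap
      (μ := torusMeasure) (ν := torusMeasure)).quasiMeasurePreserving.ae h, hf]
      with x h1 h2 h3
    have h2' : (c • f : L2Pair) (x.2, x.1) = c • f (x.2, x.1) := h2
    rw [h2', h1, h3, Pi.smul_apply]

theorem isClosed_symmetricSubspace : IsClosed (symmetricSubspace : Set L2Pair) := by
  have hs := Measure.measurePreserving_swap (μ := torusMeasure) (ν := torusMeasure)
  have h : (symmetricSubspace : Set L2Pair) =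
      {f | Lp.compMeasurePreservingₗᵢ ℂ Prod.swap hs f = f} := by
    ext f
    have hf : (Lp.compMeasurePreservingₗᵢ ℂ Prod.swap hs f : L2Pair)
        =ᵐ[torusMeasure.prod torusMeasure] f ∘ Prod.swap :=
      Lp.coeFn_compMeasurePreserving f hs
    constructor
    · intro h
      refine Lp.ext (hf.trans ?_)
      filter_upwards [h] with x hx
      exact hx
    · intro h
      have h' : (Lp.compMeasurePreservingₗᵢ ℂ Prod.swap hs f : L2Pair) = f := h
      rw [h'] at hf
      filter_upwards [hf] with x hx
      exact hx.symm
  rw [h]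
  exact isClosed_eq (LinearIsometry.continuous _) continuous_id

/-- The two-particle space `L₂ˢ((T³)²)`. -/
abbrev H2 : Type := symmetricSubspace

instance : CompleteSpace H2 := isClosed_symmetricSubspace.completeSpace_coe

/-! ### The dispersion function and the parameter functions -/

/-- `ε(k) = ∑ (1 - cos kᵢ)`. -/
def eps (k : Fin 3 → ℝ) : ℝ := ∑ i, (1 - Real.cos (k i))

/-- `w₁(k) = ε(k) + γ`. -/
def w1 (γ : ℝ) (k : Fin 3 → ℝ) : ℝ := eps k + γ

/-- `w₂(k, p) = ε(k) + ε((k + p) / 2) + ε(p)`. -/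
def w2 (k p : Fin 3 → ℝ) : ℝ := eps k + eps ((1 / 2 : ℝ) • (k + p)) + eps p

theorem continuous_eps : Continuous eps := by unfold eps; fun_prop

theorem eps_mem (k : Fin 3 → ℝ) : eps k ∈ Icc (0 : ℝ) 6 := by
  simp only [eps, Fin.sum_univ_three, mem_Icc]
  have h := fun i => Real.cos_le_one (k i)
  have h' := fun i => Real.neg_one_le_cos (k i)
  constructor <;> linarith [h 0, h 1, h 2, h' 0, h' 1, h' 2]

theorem measurable_w1 (γ : ℝ) : Measurable (w1 γ) :=
  (continuous_eps.add continuous_const).measurable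

theorem bounded_w1 (γ : ℝ) : ∃ C : ℝ, ∀ k, |w1 γ k| ≤ C := by
  refine ⟨6 + |γ|, fun k => (abs_add_le _ _).trans ?_⟩
  have := eps_mem k
  rw [abs_of_nonneg this.1]
  linarith [this.2]

theorem continuous_w2 : Continuous fun x : (Fin 3 → ℝ) × (Fin 3 → ℝ) => w2 x.1 x.2 := by
  unfold w2
  have := continuous_eps
  fun_prop

theorem w2_mem (k p : Fin 3 → ℝ) : w2 k p ∈ Icc (0 : ℝ) 18 := by
  have h1 := eps_mem k
  have h2 := eps_mem p
  have h3 := eps_mem ((1 / 2 : ℝ) • (k + p))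
  unfold w2
  constructor <;> linarith [h1.1, h1.2, h2.1, h2.2, h3.1, h3.2]

theorem abs_w2_le (k p : Fin 3 → ℝ) : |w2 k p| ≤ 18 := by
  rw [abs_of_nonneg (w2_mem k p).1]
  exact (w2_mem k p).2

theorem w2_comm (k p : Fin 3 → ℝ) : w2 k p = w2 p k := by
  unfold w2
  rw [add_comm p k]
  ring

/-! ### The entries of the operator matrices -/

/-- `(A₁₁ f₁)(k) = w₁(k) f₁(k)` on `L₂(T³)`. -/
def A11 (γ : ℝ) : H1 →L[ℂ] H1 :=
  mulOp torusMeasure (w1 γ) (measurable_w1 γ) (bounded_w1 γ)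

/-- Multiplication by `w₂(k, p)` on `L₂((T³)²)`. -/
def mulW2 : L2Pair →L[ℂ] L2Pair :=
  mulOp (torusMeasure.prod torusMeasure) (fun x => w2 x.1 x.2) continuous_w2.measurable
    ⟨18, fun x => abs_w2_le x.1 x.2⟩

theorem mulW2_mem (f : H2) : mulW2 f ∈ symmetricSubspace := by
  have h : mulW2 f =ᵐ[torusMeasure.prod torusMeasure] fun x => (w2 x.1 x.2 : ℂ) * f.1 x :=
    coeFn_mulOp _ _ _ _ _
  have hf : ∀ᵐ x ∂(torusMeasure.prod torusMeasure), f.1 (x.2, x.1) = f.1 x := f.2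
  change ∀ᵐ x ∂(torusMeasure.prod torusMeasure), mulW2 f (x.2, x.1) = mulW2 f x
  filter_upwards [h, (Measure.measurePreserving_swap
    (μ := torusMeasure) (ν := torusMeasure)).quasiMeasurePreserving.ae h, hf] with x h1 h2 h3
  have h2' : mulW2 f (x.2, x.1) = (w2 x.2 x.1 : ℂ) * f.1 (x.2, x.1) := h2
  rw [h2', h1, h3, w2_comm]

/-- `(A₂₂ f₂)(k, p) = w₂(k, p) f₂(k, p)` on `L₂ˢ((T³)²)`. -/
def A22 : H2 →L[ℂ] H2 :=
  (mulW2 ∘L symmetricSubspace.subtypeL).codRestrict symmetricSubspace mulW2_mem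

section Partial

variable {α β : Type*} [MeasurableSpace α] [MeasurableSpace β]

theorem eLpNorm_two_rpow (ρ : Measure α) (g : α → ℂ) :
    eLpNorm g 2 ρ ^ (2 : ℝ) = ∫⁻ x, ‖g x‖ₑ ^ (2 : ℝ) ∂ρ := by
  have h := eLpNorm_nnreal_pow_eq_lintegral (μ := ρ) (f := g) (p := 2) (by norm_num)
  simpa using h

theorem eLpNorm_partialIntegral_le (μ : Measure α) (ν : Measure β) [IsFiniteMeasure μ]
    [IsFiniteMeasure ν] (f : Lp ℂ 2 (μ.prod ν)) :
    eLpNorm (fun k => ∫ s, f (k, s) ∂ν) 2 μ ≤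
      (ν univ) ^ (1 / 2 : ℝ) * eLpNorm f 2 (μ.prod ν) := by
  have hm := Lp.aestronglyMeasurable f
  have h2 : (0 : ℝ) < 2 := by norm_num
  rw [← ENNReal.rpow_le_rpow_iff h2, ENNReal.mul_rpow_of_nonneg _ _ h2.le, eLpNorm_two_rpow,
    eLpNorm_two_rpow (μ.prod ν), ← ENNReal.rpow_mul, lintegral_prod _ (hm.enorm.pow_const _)]
  norm_num only [ENNReal.rpow_one]
  rw [← lintegral_const_mul' _ _ (measure_ne_top ν univ)]
  refine lintegral_mono_ae ?_
  filter_upwards [hm.prodMk_left] with k hk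
  calc ‖∫ s, f (k, s) ∂ν‖ₑ ^ (2 : ℝ)
      ≤ (∫⁻ s, ‖f (k, s)‖ₑ ∂ν) ^ (2 : ℝ) := by
        gcongr
        exact enorm_integral_le_lintegral_enorm _
    _ ≤ (eLpNorm (fun s => f (k, s)) 2 ν * ν univ ^ (1 / 2 : ℝ)) ^ (2 : ℝ) := by
        gcongr
        rw [← eLpNorm_one_eq_lintegral_enorm]
        refine (eLpNorm_le_eLpNorm_mul_rpow_measure_univ (p := 1) (q := 2) (by norm_num)
          hk).trans (le_of_eq ?_)
        norm_num
    _ = ν univ * ∫⁻ s, ‖f (k, s)‖ₑ ^ (2 : ℝ) ∂ν := by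
        rw [ENNReal.mul_rpow_of_nonneg _ _ h2.le, eLpNorm_two_rpow, ← ENNReal.rpow_mul, mul_comm]
        norm_num

theorem memLp_partialIntegral (μ : Measure α) (ν : Measure β) [IsFiniteMeasure μ]
    [IsFiniteMeasure ν] (f : Lp ℂ 2 (μ.prod ν)) :
    MemLp (fun k => ∫ s, f (k, s) ∂ν) 2 μ := by
  refine ⟨(Lp.aestronglyMeasurable f).integral_prod_right',
    (eLpNorm_partialIntegral_le μ ν f).trans_lt (ENNReal.mul_lt_top ?_ (Lp.memLp f).2)⟩
  exact ENNReal.rpow_lt_top_of_nonneg (by norm_num) (measure_ne_top ν univ)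

theorem ae_integrable_section (μ : Measure α) (ν : Measure β) [IsFiniteMeasure μ]
    [IsFiniteMeasure ν] (f : Lp ℂ 2 (μ.prod ν)) :
    ∀ᵐ k ∂μ, Integrable (fun s => f (k, s)) ν :=
  ((Lp.memLp f).integrable (by norm_num)).prod_right_ae

/-- Partial integration `f ↦ (k ↦ ∫ f(k, s) ds)` as a bounded operator `L²(μ × ν) → L²(μ)`. -/
def partialIntegral (μ : Measure α) (ν : Measure β) [IsFiniteMeasure μ]
    [IsFiniteMeasure ν] : Lp ℂ 2 (μ.prod ν) →L[ℂ] Lp ℂ 2 μ :=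
  LinearMap.mkContinuousOfExistsBound
    { toFun := fun f => (memLp_partialIntegral μ ν f).toLp _
      map_add' := fun f g => by
        apply Lp.ext
        filter_upwards [(memLp_partialIntegral μ ν (f + g)).coeFn_toLp,
          (memLp_partialIntegral μ ν f).coeFn_toLp, (memLp_partialIntegral μ ν g).coeFn_toLp,
          Measure.ae_ae_of_ae_prod (Lp.coeFn_add f g),
          ae_integrable_section μ ν f, ae_integrable_section μ ν g,
          Lp.coeFn_add ((memLp_partialIntegral μ ν f).toLp _)
            ((memLp_partialIntegral μ ν g).toLp _)] with x h1 h2 h3 h4 h5 h6 h7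
        rw [h1, h7, Pi.add_apply, h2, h3, integral_congr_ae h4]
        exact integral_add h5 h6
      map_smul' := fun c f => by
        apply Lp.ext
        filter_upwards [(memLp_partialIntegral μ ν (c • f)).coeFn_toLp,
          (memLp_partialIntegral μ ν f).coeFn_toLp,
          Measure.ae_ae_of_ae_prod (Lp.coeFn_smul c f),
          Lp.coeFn_smul c ((memLp_partialIntegral μ ν f).toLp _)] with x h1 h2 h3 h4
        rw [h1, RingHom.id_apply, h4, Pi.smul_apply, h2, integral_congr_ae h3]
        exact integral_smul c _ }
    (by
      refine ⟨((ν univ) ^ (1 / 2 : ℝ)).toReal, fun f => ?_⟩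
      change ‖(memLp_partialIntegral μ ν f).toLp _‖ ≤ _
      rw [Lp.norm_toLp, Lp.norm_def, ← ENNReal.toReal_mul]
      refine ENNReal.toReal_mono (ENNReal.mul_ne_top ?_ (Lp.memLp f).2.ne)
        (eLpNorm_partialIntegral_le μ ν f)
      exact (ENNReal.rpow_lt_top_of_nonneg (by norm_num) (measure_ne_top ν univ)).ne)

theorem coeFn_partialIntegral (μ : Measure α) (ν : Measure β) [IsFiniteMeasure μ]
    [IsFiniteMeasure ν] (f : Lp ℂ 2 (μ.prod ν)) :
    partialIntegral μ ν f =ᵐ[μ] fun k => ∫ s, f (k, s) ∂ν :=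
  (memLp_partialIntegral μ ν f).coeFn_toLp

theorem norm_integral_le_L2 (μ : Measure α) [IsFiniteMeasure μ] (f : Lp ℂ 2 μ) :
    ‖∫ t, f t ∂μ‖ ≤ (μ univ ^ (1 / 2 : ℝ)).toReal * ‖f‖ := by
  rw [← toReal_enorm, Lp.norm_def, ← ENNReal.toReal_mul]
  refine ENNReal.toReal_mono (ENNReal.mul_ne_top ?_ (Lp.memLp f).2.ne) ?_
  · exact (ENNReal.rpow_lt_top_of_nonneg (by norm_num) (measure_ne_top μ univ)).ne
  refine (enorm_integral_le_lintegral_enorm _).trans ?_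
  rw [← eLpNorm_one_eq_lintegral_enorm, mul_comm]
  refine (eLpNorm_le_eLpNorm_mul_rpow_measure_univ (p := 1) (q := 2) (by norm_num)
    (Lp.aestronglyMeasurable f)).trans (le_of_eq ?_)
  norm_num

/-- Integration `f ↦ ∫ f(t) dt` as a bounded functional on `L²(μ)`. -/
def integralL2 (μ : Measure α) [IsFiniteMeasure μ] : Lp ℂ 2 μ →L[ℂ] ℂ :=
  LinearMap.mkContinuous
    { toFun := fun f => ∫ t, f t ∂μ
      map_add' := fun f g => by
        rw [integral_congr_ae (Lp.coeFn_add f g)]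
        exact integral_add ((Lp.memLp f).integrable (by norm_num))
          ((Lp.memLp g).integrable (by norm_num))
      map_smul' := fun c f => by
        rw [integral_congr_ae (Lp.coeFn_smul c f)]
        exact integral_smul c _ }
    (μ univ ^ (1 / 2 : ℝ)).toReal (norm_integral_le_L2 μ)

end Partial

/-- The annihilation operator `(A₁₂ f₂)(k) = ∫ f₂(k, s) ds`. -/
def A12 : H2 →L[ℂ] H1 :=
  partialIntegral torusMeasure torusMeasure ∘L symmetricSubspace.subtypeL

/-- `A₀₁ f₁ = ∫ f₁(t) dt`. -/
def A01 : H1 →L[ℂ] ℂ := integralL2 torusMeasure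

/-- `A₀₀(k) f₀ = w₁(k) f₀`. -/
def A00 (γ : ℝ) (k : Fin 3 → ℝ) : ℂ →L[ℂ] ℂ := (w1 γ k : ℂ) • ContinuousLinearMap.id ℂ ℂ

/-- `(A₁₁(k) f₁)(p) = w₂(k, p) f₁(p)`. -/
def A11At (k : Fin 3 → ℝ) : H1 →L[ℂ] H1 :=
  mulOp torusMeasure (w2 k) (continuous_w2.comp (Continuous.prodMk_right k)).measurable
    ⟨18, abs_w2_le k⟩

/-! ### The operator matrices and the set `Σ_μ` -/

/-- The operator matrix `𝒜_μ = (A₁₁, μ A₁₂; μ A₁₂*, A₂₂)` in `L₂(T³) ⊕ L₂ˢ((T³)²)`. -/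
def opA (γ μ : ℝ) : WithLp 2 (H1 × H2) →L[ℂ] WithLp 2 (H1 × H2) :=
  blockMatrix (A11 γ) ((μ : ℂ) • A12) ((μ : ℂ) • ContinuousLinearMap.adjoint A12) A22

/-- The generalized Friedrichs model
`𝒜_μ(k) = (A₀₀(k), (μ/√2) A₀₁; (μ/√2) A₀₁*, A₁₁(k))` in `ℂ ⊕ L₂(T³)`. -/
def friedrichs (γ μ : ℝ) (k : Fin 3 → ℝ) : WithLp 2 (ℂ × H1) →L[ℂ] WithLp 2 (ℂ × H1) :=
  blockMatrix (A00 γ k) (((μ / Real.sqrt 2 : ℝ) : ℂ) • A01)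
    (((μ / Real.sqrt 2 : ℝ) : ℂ) • ContinuousLinearMap.adjoint A01) (A11At k)

/-- The set of values of `w₂` on `T³ × T³`. -/
def w2Values : Set ℝ := {y | ∃ k ∈ torus, ∃ p ∈ torus, w2 k p = y}

/-- `m = min w₂` over `T³ × T³`. -/
def wMin : ℝ := sInf w2Values

/-- `M = max w₂` over `T³ × T³`. -/
def wMax : ℝ := sSup w2Values

theorem zero_isLeast_w2Values : IsLeast w2Values 0 := by
  have h0 : (fun _ => 0 : Fin 3 → ℝ) ∈ torus :=
    fun i => ⟨neg_neg_of_pos Real.pi_pos, Real.pi_pos.le⟩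
  refine ⟨⟨_, h0, _, h0, ?_⟩, ?_⟩
  · simp [w2, eps]
  · rintro y ⟨k, -, p, -, rfl⟩
    exact (w2_mem k p).1

theorem eighteen_isGreatest_w2Values : IsGreatest w2Values 18 := by
  have h0 : (fun _ => Real.pi : Fin 3 → ℝ) ∈ torus :=
    fun i => ⟨by linarith [Real.pi_pos], le_rfl⟩
  refine ⟨⟨_, h0, _, h0, ?_⟩, ?_⟩
  · have : (1 / 2 : ℝ) * (Real.pi + Real.pi) = Real.pi := by ring
    simp only [w2, eps, Pi.smul_apply, Pi.add_apply, smul_eq_mul, this, Real.cos_pi,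
      Fin.sum_univ_three]
    norm_num
  · rintro y ⟨k, -, p, -, rfl⟩
    exact (w2_mem k p).2

/-- The minimum `m` is attained. -/
theorem wMin_isLeast : IsLeast w2Values wMin := by
  rw [wMin, zero_isLeast_w2Values.csInf_eq]
  exact zero_isLeast_w2Values

/-- The maximum `M` is attained. -/
theorem wMax_isGreatest : IsGreatest w2Values wMax := by
  rw [wMax, eighteen_isGreatest_w2Values.csSup_eq]
  exact eighteen_isGreatest_w2Values

/-- `Λ_μ`, the union over `k ∈ T³` of the discrete spectra of `𝒜_μ(k)`. -/
def lambdaSet (γ μ : ℝ) : Set ℂ := ⋃ k ∈ torus, discreteSpectrum (friedrichs γ μ k)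

/-- `Σ_μ = [m; M] ∪ Λ_μ`, as a subset of `ℂ`. -/
def sigmaSet (γ μ : ℝ) : Set ℂ := Complex.ofReal '' Icc wMin wMax ∪ lambdaSet γ μ

end LatticeModel

end

noncomputable section

namespace LatticeModel

open Filter Topology

/-! ### Sequentially proper operators and the essential spectrum -/

section SeqProper

variable {E F : Type*} [NormedAddCommGroup E] [NormedSpace ℂ E]
  [NormedAddCommGroup F] [NormedSpace ℂ F]

/-! Weyl's criterion is used in the following form: for a self-adjoint `T` and a real `c`, the point
`c` lies outside the essential spectrum exactly when `T - c` is sequentially proper. Sequential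
properness is unaffected by compact perturbations, and for a block matrix with invertible lower
right corner it passes to the Schur complement.

Since `w2` has minimum `0` and maximum `18`, the band is `[0, 18]`. For real `z` off the band, `A22
- z` is invertible. The Schur complement of `opA γ μ - z` on `H1` is multiplication by `fredholm γ μ
z`, plus an integral operator with kernel proportional to `(w2 - z)⁻¹`, which is compact.
Multiplication by a continuous function is sequentially proper exactly when the function has no zero
on the closed cube. Hence `z` is in the essential spectrum iff `fredholm γ μ z` vanishes somewhere.
The Schur complement of `friedrichs γ μ k - z` is the number `fredholm γ μ z k`, so the same
condition describes `lambdaSet` off the band. For `z` in the band, normalized symmetric indicators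
of small sets near a point where `w2 = z` form a singular sequence: `A22 - z` and `A12` are both
small on them.

For the intervals, `fredholm γ μ z k` is jointly continuous off the band and decreases in `z` with
slope at most `-1` on each side of it. By the intermediate value theorem on the connected cube, its
zeros on each side form an interval that either stays away from the band or reaches its edge. This
interval is not a single point, because `fredholm` is never constant in `k`. A band with at most one
detached interval on each side gives at most three intervals. -/

/-- A bounded operator is sequentially proper if every bounded sequence with convergent image has a
convergent subsequence. -/
def SeqProper (R : E →L[ℂ] F) : Prop :=
  ∀ (x : ℕ → E) (C : ℝ) (y : F), (∀ n, ‖x n‖ ≤ C) → Tendsto (fun n => R (x n)) atTop (𝓝 y) →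
    ∃ φ : ℕ → ℕ, StrictMono φ ∧ ∃ a, Tendsto (fun n => x (φ n)) atTop (𝓝 a)

theorem seqProper_of_leftInverse {R : E →L[ℂ] F} (S : F →L[ℂ] E) (h : ∀ x, S (R x) = x) :
    SeqProper R := by
  intro x C y _ hy
  refine ⟨id, strictMono_id, S y, ?_⟩
  have := (S.continuous.tendsto y).comp hy
  simpa [Function.comp_def, h] using this

theorem seqProper_of_isUnit {R : E →L[ℂ] E} (h : IsUnit R) : SeqProper R := by
  obtain ⟨u, rfl⟩ := h
  refine seqProper_of_leftInverse (↑u⁻¹ : E →L[ℂ] E) fun x => ?_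
  exact congrArg (fun S : E →L[ℂ] E => S x) u.inv_mul

theorem seqProper_of_finiteDimensional [FiniteDimensional ℂ E] (R : E →L[ℂ] F) :
    SeqProper R := by
  intro x C y hx _
  have := FiniteDimensional.proper ℂ E
  obtain ⟨a, -, φ, hφ, ha⟩ := (isCompact_closedBall (0 : E) C).tendsto_subseq (x := x)
    (fun n => by simpa using hx n)
  exact ⟨φ, hφ, a, ha⟩

/-- Along a subsequence `K (x n)` converges, so `R (x n)` converges as well and properness of `R`
applies. -/
theorem SeqProper.add_isCompactOperator {R K : E →L[ℂ] F} (hR : SeqProper R)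
    (hK : IsCompactOperator K) : SeqProper (R + K) := by
  intro x C y hx hy
  have hc := IsCompactOperator.isCompact_closure_image_closedBall
    (f := (K : E →ₗ[ℂ] F)) hK C
  obtain ⟨b, -, φ, hφ, hb⟩ := hc.tendsto_subseq (x := fun n => K (x n))
    (fun n => subset_closure ⟨x n, by simpa using hx n, rfl⟩)
  have h1 : Tendsto (fun n => R (x (φ n))) atTop (𝓝 (y - b)) := by
    refine ((hy.comp hφ.tendsto_atTop).sub hb).congr fun n => ?_
    simp
  obtain ⟨ψ, hψ, a, ha⟩ := hR (fun n => x (φ n)) C _ (fun n => hx _) h1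
  exact ⟨φ ∘ ψ, hφ.comp hψ, a, ha⟩

theorem seqProper_add_isCompactOperator_iff {R K : E →L[ℂ] F} (hK : IsCompactOperator K) :
    SeqProper (R + K) ↔ SeqProper R := by
  refine ⟨fun h => ?_, fun h => h.add_isCompactOperator hK⟩
  have h' := h.add_isCompactOperator (K := -K) hK.neg
  simpa using h'

/-- An operator is not sequentially proper if it has approximate null vectors of unit norm that
tend to zero with respect to a weaker norm. -/
theorem not_seqProper_of_approx {R : E →L[ℂ] F} (N : E → ℝ) (hN : Continuous N)
    (hN0 : ∀ x, N x = 0 → x = 0)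
    (h : ∀ ε > 0, ∃ x, ‖x‖ = 1 ∧ ‖R x‖ ≤ ε ∧ |N x| ≤ ε) : ¬ SeqProper R := by
  intro hR
  have hpos : ∀ n : ℕ, (0 : ℝ) < 1 / ((n : ℝ) + 1) := fun n => by positivity
  choose x hx1 hx2 hx3 using fun n : ℕ => h _ (hpos n)
  have hlim := tendsto_one_div_add_atTop_nhds_zero_nat (𝕜 := ℝ)
  obtain ⟨φ, hφ, a, ha⟩ := hR x 1 0 (fun n => (hx1 n).le)
    (squeeze_zero_norm hx2 hlim)
  have hNa : N a = 0 := by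
    refine tendsto_nhds_unique ((hN.tendsto a).comp ha) ?_
    exact squeeze_zero_norm (fun n => hx3 (φ n)) (hlim.comp hφ.tendsto_atTop)
  have h1 : ‖a‖ = 1 := by
    refine tendsto_nhds_unique ha.norm ?_
    simp [hx1]
  rw [hN0 a hNa] at h1
  simp at h1

/-- This is Riesz's theorem: on the kernel the images are constantly `0`, so properness makes its
closed unit ball sequentially compact. -/
theorem SeqProper.finiteDimensional_ker {R : E →L[ℂ] F} (hR : SeqProper R) :
    FiniteDimensional ℂ (LinearMap.ker (R : E →ₗ[ℂ] F)) := by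
  refine FiniteDimensional.of_isCompact_closedBall ℂ one_pos (c := 0) ?_
  refine IsSeqCompact.isCompact fun x hx => ?_
  have hx' : ∀ n, ‖(x n : E)‖ ≤ 1 := fun n => by simpa using hx n
  obtain ⟨φ, hφ, a, ha⟩ := hR (fun n => (x n : E)) 1 0 hx' (by
    refine tendsto_const_nhds.congr fun n => ?_
    exact ((x n).2 : R (x n) = 0).symm)
  have hker : R a = 0 := by
    refine tendsto_nhds_unique ((R.continuous.tendsto a).comp ha) ?_
    refine tendsto_const_nhds.congr fun n => ?_
    exact ((x (φ n)).2 : R (x (φ n)) = 0).symm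
  refine ⟨⟨a, hker⟩, ?_, φ, hφ, ?_⟩
  · have : ‖a‖ ≤ 1 := le_of_tendsto ha.norm (Eventually.of_forall fun n => hx' _)
    simpa using this
  · rw [tendsto_subtype_rng]
    exact ha

end SeqProper

/-! ### Weyl's criterion for self-adjoint operators -/

section Hilbert

variable {E : Type*} [NormedAddCommGroup E] [InnerProductSpace ℂ E]

theorem hasEigenvalue_of_apply_eq {T : E →L[ℂ] E} {z : ℂ} {x : E} (hx : x ≠ 0)
    (h : T x = z • x) : Module.End.HasEigenvalue (T : E →ₗ[ℂ] E) z :=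
  Module.End.hasEigenvalue_of_hasEigenvector
    (Module.End.hasEigenvector_iff.2 ⟨Module.End.mem_eigenspace_iff.2 h, hx⟩)

theorem eigenspace_eq_ker (T : E →L[ℂ] E) (z : ℂ) :
    Module.End.eigenspace (T : E →ₗ[ℂ] E) z =
      LinearMap.ker ((T - algebraMap ℂ (E →L[ℂ] E) z : E →L[ℂ] E) : E →ₗ[ℂ] E) := by
  ext x
  rw [Module.End.mem_eigenspace_iff, LinearMap.mem_ker]
  simp [sub_eq_zero, Algebra.algebraMap_eq_smul_one]

theorem notMem_spectrum_iff {T : E →L[ℂ] E} {z : ℂ} :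
    z ∉ spectrum ℂ T ↔ IsUnit (T - algebraMap ℂ (E →L[ℂ] E) z) := by
  rw [spectrum.notMem_iff, ← IsUnit.neg_iff, neg_sub]

variable [CompleteSpace E]

/-- The hypothesis says that `R` is bounded below, hence injective with closed range. The orthogonal
complement of the range of a self-adjoint operator is its kernel, which is zero, so the range is
everything. -/
theorem isUnit_of_bounded_below {R : E →L[ℂ] E} (hR : IsSelfAdjoint R)
    (h : ∀ x : ℕ → E, (∀ n, ‖x n‖ = 1) → ¬ Tendsto (fun n => R (x n)) atTop (𝓝 0)) :
    IsUnit R := by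
  obtain ⟨c, hc⟩ : ∃ c : NNReal, ∀ x, ‖x‖ ≤ c * ‖R x‖ := by
    by_contra! hcon
    choose x hx using fun n : ℕ => hcon ((n : NNReal) + 1)
    have hx0 : ∀ n, 0 < ‖x n‖ := fun n => lt_of_le_of_lt (by positivity) (hx n)
    refine h (fun n => ((‖x n‖⁻¹ : ℝ) : ℂ) • x n) (fun n => ?_) ?_
    · rw [norm_smul, Complex.norm_real, norm_inv, norm_norm, inv_mul_cancel₀ (hx0 n).ne']
    · refine squeeze_zero_norm (fun n => ?_) (tendsto_one_div_add_atTop_nhds_zero_nat (𝕜 := ℝ))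
      have h1 := hx n
      push_cast at h1
      rw [map_smul, norm_smul, Complex.norm_real, norm_inv, norm_norm, inv_mul_le_iff₀ (hx0 n),
        mul_one_div, le_div_iff₀ (by positivity), mul_comm]
      exact h1.le
  rw [ContinuousLinearMap.isUnit_iff_bijective,
    ContinuousLinearMap.bijective_iff_dense_range_and_antilipschitz]
  refine ⟨?_, c, R.antilipschitz_of_bound hc⟩
  rw [Submodule.topologicalClosure_eq_top_iff, Submodule.eq_bot_iff]
  intro x hx
  have h2 : R x = 0 := by
    refine ext_inner_left ℂ fun v => ?_
    have h3 := hx (R v) ⟨v, rfl⟩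
    rw [inner_zero_right, ← ContinuousLinearMap.adjoint_inner_left,
      ContinuousLinearMap.isSelfAdjoint_iff'.1 hR]
    exact h3
  have h4 := hc x
  rw [h2, norm_zero, mul_zero] at h4
  exact norm_le_zero_iff.1 h4

/-- The identity `R - h = (R + P - h) * (1 - (1 - h)⁻¹ • P)` holds, and the last factor has inverse
`1 - h⁻¹ • P`. -/
theorem isUnit_sub_of_isUnit_add {A : Type*} [Ring A] [Algebra ℂ A] {R P : A} (hRP : R * P = 0)
    (hP : P * P = P) {h : ℂ} (h0 : h ≠ 0) (h1 : h ≠ 1)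
    (hU : IsUnit (R + P - algebraMap ℂ A h)) : IsUnit (R - algebraMap ℂ A h) := by
  have h2 : (1 - h) ≠ 0 := sub_ne_zero.2 h1.symm
  have key : ∀ c d : ℂ, c + d - c * d = 0 → (1 - c • P) * (1 - d • P) = 1 := by
    intro c d hcd
    have : (1 - c • P) * (1 - d • P) = 1 - (c + d - c * d) • P := by
      simp only [mul_sub, sub_mul, mul_one, one_mul, smul_mul_smul_comm, hP, sub_smul, add_smul]
      abel
    rw [this, hcd, zero_smul, sub_zero]
  have hv : IsUnit (1 - (1 - h)⁻¹ • P) :=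
    ⟨⟨_, 1 - h⁻¹ • P, key _ _ (by field_simp; ring), key _ _ (by field_simp; ring)⟩, rfl⟩
  convert hU.mul hv using 1
  rw [mul_sub, mul_one, mul_smul_comm, sub_mul, add_mul, hRP, hP, zero_add,
    ← Algebra.smul_def, show P - h • P = (1 - h) • P by rw [sub_smul, one_smul], smul_smul,
    inv_mul_cancel₀ h2, one_smul]
  abel

theorem isSelfAdjoint_sub_algebraMap {T : E →L[ℂ] E} (hT : IsSelfAdjoint T) (c : ℝ) :
    IsSelfAdjoint (T - algebraMap ℂ (E →L[ℂ] E) c) := by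
  refine hT.sub ?_
  rw [IsSelfAdjoint, ← algebraMap_star_comm]
  simp

/-- `P` is the orthogonal projection onto the finite-dimensional kernel of `R`. If `(R + P) xₙ → 0`
with unit `xₙ`, applying `P` and using `P R = 0` gives `P xₙ → 0` and then `R xₙ → 0`. A limit of a
subsequence lies in the kernel and is killed by `P`, so it is zero, although its norm is one. -/
theorem SeqProper.exists_add_isUnit {R : E →L[ℂ] E} (hR : IsSelfAdjoint R) (hp : SeqProper R) :
    ∃ P : E →L[ℂ] E, R * P = 0 ∧ P * P = P ∧ IsUnit (R + P) ∧ ∀ x, R x = 0 → P x = x := by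
  have hfin := hp.finiteDimensional_ker
  set N := LinearMap.ker (R : E →ₗ[ℂ] E) with hN
  have hRP : ∀ x, R (N.starProjection x) = 0 := fun x => (N.starProjection_apply_mem x : _)
  have hPR : ∀ x, N.starProjection (R x) = 0 := by
    intro x
    rw [Submodule.starProjection_apply_eq_zero_iff]
    intro v hv
    rw [← ContinuousLinearMap.adjoint_inner_left, ContinuousLinearMap.isSelfAdjoint_iff'.1 hR,
      show R v = 0 from hv, inner_zero_left]
  have hPP : ∀ x, N.starProjection (N.starProjection x) = N.starProjection x := fun x =>
    Submodule.starProjection_eq_self_iff.2 (N.starProjection_apply_mem x)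
  refine ⟨N.starProjection, ContinuousLinearMap.ext hRP, ContinuousLinearMap.ext hPP, ?_,
    fun x hx => Submodule.starProjection_eq_self_iff.2 hx⟩
  refine isUnit_of_bounded_below (hR.add (isSelfAdjoint_starProjection N)) fun x hx hlim => ?_
  have h1 : Tendsto (fun n => N.starProjection (x n)) atTop (𝓝 0) := by
    have := (N.starProjection.continuous.tendsto _).comp hlim
    simpa [Function.comp_def, hPR, hPP] using this
  have h2 : Tendsto (fun n => R (x n)) atTop (𝓝 0) := by
    simpa using hlim.sub h1
  obtain ⟨φ, hφ, a, ha⟩ := hp x 1 0 (fun n => (hx n).le) h2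
  have hRa : R a = 0 := tendsto_nhds_unique ((R.continuous.tendsto a).comp ha)
    (h2.comp hφ.tendsto_atTop)
  have hPa : N.starProjection a = 0 := tendsto_nhds_unique
    ((N.starProjection.continuous.tendsto a).comp ha) (h1.comp hφ.tendsto_atTop)
  rw [Submodule.starProjection_eq_self_iff.2 (hRa : a ∈ N)] at hPa
  have h3 : ‖a‖ = 1 := tendsto_nhds_unique ha.norm (by simp [hx])
  simp [hPa] at h3

/-- Invertibility of `R + P` survives a small shift, and removing `P` then spoils it only at `c`
itself, so `c` is isolated. Were there no eigenvector, `P` would vanish and `R` would be invertible.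
-/
theorem mem_discreteSpectrum_of_seqProper {T : E →L[ℂ] E} (hT : IsSelfAdjoint T) {c : ℝ}
    (hp : SeqProper (T - algebraMap ℂ (E →L[ℂ] E) c)) (hc : (c : ℂ) ∈ spectrum ℂ T) :
    (c : ℂ) ∈ discreteSpectrum T := by
  obtain ⟨P, hRP, hPP, hU, hfix⟩ := hp.exists_add_isUnit (isSelfAdjoint_sub_algebraMap hT c)
  set R := T - algebraMap ℂ (E →L[ℂ] E) c with hR
  refine ⟨hc, ?_, ?_, ?_⟩
  · have hcont : Continuous fun w : ℂ => R + P - algebraMap ℂ (E →L[ℂ] E) (w - c) := by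
      simp only [Algebra.algebraMap_eq_smul_one]
      fun_prop
    have hopen : {w : ℂ | IsUnit (R + P - algebraMap ℂ (E →L[ℂ] E) (w - c))} ∈ 𝓝 (c : ℂ) := by
      refine (Units.isOpen.preimage hcont).mem_nhds ?_
      simpa using hU
    obtain ⟨r, hr, hball⟩ := Metric.mem_nhds_iff.1 hopen
    -- The radius is at most `1` so that the shift `h = w - c` differs from `1`, as
    -- `isUnit_sub_of_isUnit_add` requires.
    refine ⟨min r 1, by positivity, ?_⟩
    refine Subset.antisymm ?_ (by
      rintro _ rfl
      exact ⟨Metric.mem_ball_self (by positivity), hc⟩)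
    rintro w ⟨hw, hwT⟩
    by_contra hne
    refine (notMem_spectrum_iff.2 ?_) hwT
    have hwr : w ∈ Metric.ball (c : ℂ) r := Metric.ball_subset_ball (min_le_left _ _) hw
    have hw1 : ‖w - c‖ < 1 := by
      rw [← dist_eq_norm]
      exact (Metric.mem_ball.1 hw).trans_le (min_le_right _ _)
    have := isUnit_sub_of_isUnit_add hRP hPP (h := w - c) (sub_ne_zero.2 hne)
      (fun h => by rw [h, norm_one] at hw1; exact lt_irrefl _ hw1) (hball hwr)
    rw [hR, map_sub] at this
    simpa using this
  · by_contra hne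
    have hP0 : P = 0 := by
      ext x
      by_contra hx
      refine hne (hasEigenvalue_of_apply_eq hx ?_)
      have := congrArg (fun S : E →L[ℂ] E => S x) hRP
      simpa [hR, sub_eq_zero, Algebra.algebraMap_eq_smul_one] using this
    rw [hP0, add_zero] at hU
    exact notMem_spectrum_iff.2 hU hc
  · rw [eigenspace_eq_ker]
    exact hp.finiteDimensional_ker

/-- The indicator of an isolated spectral point is continuous on the spectrum, so the functional
calculus yields the spectral projection `P`. Its range lies in the finite-dimensional eigenspace,
hence it is compact. The function `x - z + f x` has no zero, so `T - z + P` is invertible and `T -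
z` is a compact perturbation of it. -/
theorem seqProper_of_mem_discreteSpectrum {T : E →L[ℂ] E} (hT : IsSelfAdjoint T) {z : ℂ}
    (hz : z ∈ discreteSpectrum T) : SeqProper (T - algebraMap ℂ (E →L[ℂ] E) z) := by
  obtain ⟨hzT, ⟨r, hr, hball⟩, -, hfin⟩ := hz
  have hT' : IsStarNormal T := hT.isStarNormal
  classical
  set f : ℂ → ℂ := fun x => if x = z then 1 else 0 with hf
  have hfc : ContinuousOn f (spectrum ℂ T) := by
    intro w hw
    have hopen : ∃ U ∈ 𝓝 w, ∀ v ∈ U ∩ spectrum ℂ T, f v = f w := by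
      by_cases hwz : w = z
      · subst hwz
        refine ⟨Metric.ball w r, Metric.ball_mem_nhds _ hr, fun v hv => ?_⟩
        rw [hball] at hv
        rw [mem_singleton_iff.1 hv]
      · refine ⟨{z}ᶜ, isOpen_compl_singleton.mem_nhds hwz, fun v hv => ?_⟩
        have : v ≠ z := hv.1
        simp [hf, this, hwz]
    obtain ⟨U, hU, hUf⟩ := hopen
    refine tendsto_const_nhds.congr' ?_
    filter_upwards [inter_mem_nhdsWithin (spectrum ℂ T) hU] with v hv
    exact (hUf v ⟨hv.2, hv.1⟩).symm
  set P := cfc f T with hP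
  have hsub : T - algebraMap ℂ (E →L[ℂ] E) z = cfc (fun x : ℂ => x - z) T := by
    rw [cfc_sub (fun x : ℂ => x) (fun _ => z) T, cfc_id' ℂ T, cfc_const z T]
  have hmul : (T - algebraMap ℂ (E →L[ℂ] E) z) * P = 0 := by
    rw [hsub, hP, ← cfc_mul (fun x : ℂ => x - z) f T]
    have : (fun x : ℂ => (x - z) * f x) = fun _ => 0 := by
      funext x
      by_cases hx : x = z <;> simp [hf, hx]
    rw [this]
    simp
  have hunit : IsUnit (T - algebraMap ℂ (E →L[ℂ] E) z + P) := by
    rw [hsub, hP, ← cfc_add T (fun x : ℂ => x - z) f, isUnit_cfc_iff _ T]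
    intro x _
    by_cases hx : x = z
    · simp [hf, hx]
    · simpa [hf, hx] using sub_ne_zero.2 hx
  have hcomp : IsCompactOperator P := by
    rw [eigenspace_eq_ker] at hfin
    have hmem : ∀ x, P x ∈ LinearMap.ker ((T - algebraMap ℂ (E →L[ℂ] E) z : E →L[ℂ] E) :
        E →ₗ[ℂ] E) := fun x => congrArg (fun S : E →L[ℂ] E => S x) hmul
    have := FiniteDimensional.proper ℂ (LinearMap.ker
      ((T - algebraMap ℂ (E →L[ℂ] E) z : E →L[ℂ] E) : E →ₗ[ℂ] E))
    exact IsCompactOperator.clm_comp (isCompactOperator_of_locallyCompactSpace_dom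
      (P.codRestrict _ hmem)) (Submodule.subtypeL _)
  simpa using (seqProper_of_isUnit hunit).add_isCompactOperator (K := -P) hcomp.neg

/-- **Weyl's criterion** for the essential spectrum of a bounded self-adjoint operator. -/
theorem mem_essentialSpectrum_iff {T : E →L[ℂ] E} (hT : IsSelfAdjoint T) {c : ℝ} :
    (c : ℂ) ∈ essentialSpectrum T ↔ ¬ SeqProper (T - algebraMap ℂ (E →L[ℂ] E) c) := by
  constructor
  · rintro ⟨h1, h2⟩ h3
    exact h2 (mem_discreteSpectrum_of_seqProper hT h3 h1)
  · intro h
    refine ⟨?_, fun h' => h (seqProper_of_mem_discreteSpectrum hT h')⟩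
    by_contra h1
    exact h (seqProper_of_isUnit (notMem_spectrum_iff.1 h1))

theorem ofReal_re_of_mem_spectrum {T : E →L[ℂ] E} (hT : IsSelfAdjoint T) {z : ℂ}
    (hz : z ∈ spectrum ℂ T) : ((z.re : ℝ) : ℂ) = z := (hT.mem_spectrum_eq_re hz).symm

end Hilbert

/-! ### Block operator matrices and Schur complements -/

section Block

theorem norm_fst_le_norm {E F : Type*} [NormedAddCommGroup E] [NormedAddCommGroup F]
    (x : WithLp 2 (E × F)) : ‖x.fst‖ ≤ ‖x‖ := by
  refine le_of_sq_le_sq ?_ (norm_nonneg _)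
  rw [WithLp.prod_norm_sq_eq_of_L2]
  nlinarith [norm_nonneg x.snd]

theorem norm_toLp_le {E F : Type*} [NormedAddCommGroup E] [NormedAddCommGroup F]
    (x : E) (y : F) : ‖(WithLp.toLp 2 (x, y) : WithLp 2 (E × F))‖ ≤ ‖x‖ + ‖y‖ := by
  refine le_of_sq_le_sq ?_ (by positivity)
  rw [WithLp.prod_norm_sq_eq_of_L2]
  simp only [WithLp.toLp_fst, WithLp.toLp_snd]
  nlinarith [norm_nonneg x, norm_nonneg y]

variable {E F : Type*} [NormedAddCommGroup E] [InnerProductSpace ℂ E]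
  [NormedAddCommGroup F] [InnerProductSpace ℂ F]

theorem blockMatrix_apply' (A : E →L[ℂ] E) (B : F →L[ℂ] E) (C : E →L[ℂ] F) (D : F →L[ℂ] F)
    (x : WithLp 2 (E × F)) :
    blockMatrix A B C D x = WithLp.toLp 2 (A x.fst + B x.snd, C x.fst + D x.snd) := rfl

theorem isSelfAdjoint_blockMatrix [CompleteSpace E] [CompleteSpace F] {A : E →L[ℂ] E}
    {B : F →L[ℂ] E} {D : F →L[ℂ] F} (hA : IsSelfAdjoint A) (hD : IsSelfAdjoint D) :
    IsSelfAdjoint (blockMatrix A B (ContinuousLinearMap.adjoint B) D) := by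
  rw [ContinuousLinearMap.isSelfAdjoint_iff'] at hA hD ⊢
  symm
  rw [ContinuousLinearMap.eq_adjoint_iff]
  intro x y
  simp only [blockMatrix_apply', WithLp.prod_inner_apply, inner_add_left, inner_add_right,
    ContinuousLinearMap.adjoint_inner_left]
  have h1 : inner ℂ (A x.fst) y.fst = inner ℂ x.fst (A y.fst) := by
    rw [← ContinuousLinearMap.adjoint_inner_left, hA]
  have h2 : inner ℂ (D x.snd) y.snd = inner ℂ x.snd (D y.snd) := by
    rw [← ContinuousLinearMap.adjoint_inner_left, hD]
  have h3 : inner ℂ (B x.snd) y.fst = inner ℂ x.snd (ContinuousLinearMap.adjoint B y.fst) := by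
    rw [ContinuousLinearMap.adjoint_inner_right]
  simp only [WithLp.ofLp_fst, WithLp.ofLp_snd] at *
  rw [h1, h2, h3]
  ring

theorem blockMatrix_sub_algebraMap (A : E →L[ℂ] E) (B : F →L[ℂ] E) (C : E →L[ℂ] F)
    (D : F →L[ℂ] F) (z : ℂ) :
    blockMatrix A B C D - algebraMap ℂ _ z =
      blockMatrix (A - algebraMap ℂ _ z) B C (D - algebraMap ℂ _ z) := by
  refine ContinuousLinearMap.ext fun x => (WithLp.equiv 2 (E × F)).injective (Prod.ext ?_ ?_)
  · change A x.fst + B x.snd - (algebraMap ℂ (WithLp 2 (E × F) →L[ℂ] WithLp 2 (E × F)) z x).fst =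
      (A - algebraMap ℂ _ z) x.fst + B x.snd
    simp [Algebra.algebraMap_eq_smul_one]
    abel
  · change C x.fst + D x.snd - (algebraMap ℂ (WithLp 2 (E × F) →L[ℂ] WithLp 2 (E × F)) z x).snd =
      C x.fst + (D - algebraMap ℂ _ z) x.snd
    simp [Algebra.algebraMap_eq_smul_one]
    abel

theorem tendsto_toLp_iff {x : ℕ → WithLp 2 (E × F)} {a : WithLp 2 (E × F)} :
    Tendsto x atTop (𝓝 a) ↔ Tendsto (fun n => (x n).fst) atTop (𝓝 a.fst) ∧
      Tendsto (fun n => (x n).snd) atTop (𝓝 a.snd) := by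
  rw [(WithLp.prodContinuousLinearEquiv 2 ℂ E F).toHomeomorph.isInducing.tendsto_nhds_iff,
    Prod.tendsto_iff]
  rfl

/-- A block operator matrix with an invertible lower right entry is sequentially proper if and only
if its Schur complement is. -/
theorem seqProper_blockMatrix_iff {A : E →L[ℂ] E} {B : F →L[ℂ] E} {C : E →L[ℂ] F}
    {D D' : F →L[ℂ] F} (h1 : ∀ y, D (D' y) = y) (h2 : ∀ y, D' (D y) = y) :
    SeqProper (blockMatrix A B C D) ↔ SeqProper (A - B ∘L D' ∘L C) := by
  constructor
  · intro h x K y hx hy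
    -- The second component is chosen so that the second row of the matrix vanishes, which leaves
    -- the Schur complement in the first row.
    have hb : ∀ n, ‖(WithLp.toLp 2 (x n, -(D' (C (x n)))) : WithLp 2 (E × F))‖ ≤
        K + ‖D' ∘L C‖ * K := by
      intro n
      refine (norm_toLp_le _ _).trans (add_le_add (hx n) ?_)
      rw [norm_neg]
      exact ((D' ∘L C).le_opNorm (x n)).trans (by gcongr; exact hx n)
    have hlim : Tendsto (fun n => blockMatrix A B C D (WithLp.toLp 2 (x n, -(D' (C (x n))))))
        atTop (𝓝 (WithLp.toLp 2 (y, 0))) := by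
      rw [tendsto_toLp_iff]
      refine ⟨hy.congr fun n => ?_, tendsto_const_nhds.congr fun n => ?_⟩
      · simp [blockMatrix_apply, sub_eq_add_neg]
      · simp [blockMatrix_apply, h1]
    obtain ⟨φ, hφ, a, ha⟩ := h _ _ _ hb hlim
    exact ⟨φ, hφ, a.fst, (tendsto_toLp_iff.1 ha).1⟩
  · intro h x K y hx hy
    rw [tendsto_toLp_iff] at hy
    obtain ⟨hy1, hy2⟩ := hy
    simp only [blockMatrix_apply', WithLp.toLp_fst, WithLp.toLp_snd] at hy1 hy2
    obtain ⟨φ, hφ, a, ha⟩ := h (fun n => (x n).fst) K (y.fst - B (D' y.snd))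
      (fun n => (norm_fst_le_norm _).trans (hx n)) (by
        refine (hy1.sub (((B ∘L D').continuous.tendsto _).comp hy2)).congr fun n => ?_
        simp [h2])
    -- Once the first components converge, the second row determines the limit of the second ones,
    -- because `D` is invertible.
    refine ⟨φ, hφ, WithLp.toLp 2 (a, D' (y.snd - C a)), tendsto_toLp_iff.2 ⟨ha, ?_⟩⟩
    have h3 : Tendsto (fun n => D' (C (x (φ n)).fst + D (x (φ n)).snd - C (x (φ n)).fst)) atTop
        (𝓝 (D' (y.snd - C a))) :=
      (D'.continuous.tendsto _).comp
        ((hy2.comp hφ.tendsto_atTop).sub ((C.continuous.tendsto _).comp ha))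
    simpa [h2] using h3

end Block

/-! ### Multiplication operators and integral operators -/

section MulOp

variable {α : Type*} [MeasurableSpace α] {ν : Measure α}

theorem mulOp_mulOp_of_mul_eq_one {v w : α → ℝ} (hv : Measurable v) (hbv : ∃ C : ℝ, ∀ x, |v x| ≤ C)
    (hw : Measurable w) (hbw : ∃ C : ℝ, ∀ x, |w x| ≤ C) (h : ∀ᵐ x ∂ν, v x * w x = 1)
    (f : Lp ℂ 2 ν) :
    mulOp ν v hv hbv (mulOp ν w hw hbw f) = f := by
  refine Lp.ext ?_
  filter_upwards [coeFn_mulOp ν v hv hbv (mulOp ν w hw hbw f), coeFn_mulOp ν w hw hbw f, h]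
    with x h1 h2 h3
  rw [h1, h2, ← mul_assoc, ← Complex.ofReal_mul, h3, Complex.ofReal_one, one_mul]

theorem mulOp_sub_algebraMap {w : α → ℝ} (hw : Measurable w) (hbw : ∃ C : ℝ, ∀ x, |w x| ≤ C) (c : ℝ)
    (hw' : Measurable fun x => w x - c) (hbw' : ∃ C : ℝ, ∀ x, |w x - c| ≤ C) :
    mulOp ν w hw hbw - algebraMap ℂ (Lp ℂ 2 ν →L[ℂ] Lp ℂ 2 ν) c =
      mulOp ν (fun x => w x - c) hw' hbw' := by
  refine ContinuousLinearMap.ext fun f => Lp.ext ?_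
  have h0 : (mulOp ν w hw hbw - algebraMap ℂ (Lp ℂ 2 ν →L[ℂ] Lp ℂ 2 ν) c) f =
      mulOp ν w hw hbw f - (c : ℂ) • f := by
    rw [_root_.sub_apply, Algebra.algebraMap_eq_smul_one]
    rfl
  rw [h0]
  filter_upwards [coeFn_mulOp ν w hw hbw f, coeFn_mulOp ν _ hw' hbw' f,
    Lp.coeFn_sub (mulOp ν w hw hbw f) ((c : ℂ) • f), Lp.coeFn_smul (c : ℂ) f] with x h1 h2 h3 h4
  rw [h3, Pi.sub_apply, h1, h2, h4, Pi.smul_apply, smul_eq_mul, Complex.ofReal_sub, sub_mul]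

theorem isSelfAdjoint_mulOp {w : α → ℝ} (hw : Measurable w) (hbw : ∃ C : ℝ, ∀ x, |w x| ≤ C) :
    IsSelfAdjoint (mulOp ν w hw hbw) := by
  rw [ContinuousLinearMap.isSelfAdjoint_iff']
  symm
  rw [ContinuousLinearMap.eq_adjoint_iff]
  intro f g
  rw [L2.inner_def, L2.inner_def]
  refine integral_congr_ae ?_
  filter_upwards [coeFn_mulOp ν w hw hbw f, coeFn_mulOp ν w hw hbw g] with x h1 h2
  rw [h1, h2]
  simp only [RCLike.inner_apply, map_mul, Complex.conj_ofReal]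
  ring

theorem norm_mulOp_le {w : α → ℝ} (hw : Measurable w) (hbw : ∃ C : ℝ, ∀ x, |w x| ≤ C) {f : Lp ℂ 2 ν}
    {S : Set α} {δ : ℝ} (hf : ∀ᵐ x ∂ν, x ∉ S → f x = 0) (hS : ∀ x ∈ S, |w x| ≤ δ) :
    ‖mulOp ν w hw hbw f‖ ≤ δ * ‖f‖ := by
  refine Lp.norm_le_mul_norm_of_ae_le_mul ?_
  filter_upwards [coeFn_mulOp ν w hw hbw f, hf] with x h1 h2
  rw [h1, norm_mul, Complex.norm_real, Real.norm_eq_abs]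
  by_cases hx : x ∈ S
  · exact mul_le_mul_of_nonneg_right (hS x hx) (norm_nonneg _)
  · simp [h2 hx]

/-- The `L¹` norm of an `L²` function. -/
def l1Norm (f : Lp ℂ 2 ν) : ℝ := ∫ x, ‖f x‖ ∂ν

theorem l1Norm_nonneg (f : Lp ℂ 2 ν) : 0 ≤ l1Norm f := integral_nonneg fun _ => norm_nonneg _

variable [IsFiniteMeasure ν]

theorem integrable_coeFn (f : Lp ℂ 2 ν) : Integrable f ν := (Lp.memLp f).integrable (by norm_num)

theorem l1Norm_le (f : Lp ℂ 2 ν) : l1Norm f ≤ (ν univ ^ (1 / 2 : ℝ)).toReal * ‖f‖ := by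
  rw [l1Norm, integral_norm_eq_lintegral_enorm (Lp.aestronglyMeasurable f), Lp.norm_def,
    ← ENNReal.toReal_mul]
  refine ENNReal.toReal_mono (ENNReal.mul_ne_top ?_ (Lp.memLp f).2.ne) ?_
  · exact (ENNReal.rpow_lt_top_of_nonneg (by norm_num) (measure_ne_top ν univ)).ne
  rw [← eLpNorm_one_eq_lintegral_enorm, mul_comm]
  refine (eLpNorm_le_eLpNorm_mul_rpow_measure_univ (p := 1) (q := 2) (by norm_num)
    (Lp.aestronglyMeasurable f)).trans (le_of_eq ?_)
  norm_num

theorem continuous_l1Norm : Continuous (l1Norm : Lp ℂ 2 ν → ℝ) := by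
  have key : ∀ f g : Lp ℂ 2 ν, l1Norm f ≤ l1Norm g + l1Norm (f - g) := by
    intro f g
    rw [l1Norm, l1Norm, l1Norm, ← integral_add (integrable_coeFn g).norm
      (integrable_coeFn (f - g)).norm]
    refine integral_mono_ae (integrable_coeFn f).norm
      ((integrable_coeFn g).norm.add (integrable_coeFn (f - g)).norm) ?_
    filter_upwards [Lp.coeFn_sub f g] with x hx
    rw [hx, Pi.sub_apply]
    simpa using norm_add_le (g x) (f x - g x)
  refine (LipschitzWith.of_le_add_mul (ν univ ^ (1 / 2 : ℝ)).toNNReal fun f g => ?_).continuous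
  refine (key f g).trans ?_
  rw [dist_eq_norm]
  gcongr
  exact l1Norm_le (f - g)

theorem eq_zero_of_l1Norm_eq_zero {f : Lp ℂ 2 ν} (h : l1Norm f = 0) : f = 0 := by
  rw [l1Norm, integral_eq_zero_iff_of_nonneg (fun _ => norm_nonneg _)
    (integrable_coeFn f).norm] at h
  refine Lp.ext ?_
  filter_upwards [h, Lp.coeFn_zero ℂ 2 ν] with x h1 h2
  rw [h2]
  simpa using h1

/-- The normalized indicator function of a set of positive measure. -/
theorem exists_normalized_indicator {S : Set α} (hS : MeasurableSet S) (h0 : 0 < ν.real S) :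
    ∃ (f : Lp ℂ 2 ν) (c : ℝ), 0 < c ∧ c ^ 2 * ν.real S = 1 ∧ ‖f‖ = 1 ∧
      (f =ᵐ[ν] S.indicator fun _ => (c : ℂ)) ∧ l1Norm f ^ 2 = ν.real S := by
  have hs : 0 < √(ν.real S) := Real.sqrt_pos.2 h0
  have hsq : √(ν.real S) ^ 2 = ν.real S := Real.sq_sqrt h0.le
  refine ⟨indicatorConstLp 2 hS (measure_ne_top ν S) (((√(ν.real S))⁻¹ : ℝ) : ℂ),
    (√(ν.real S))⁻¹, inv_pos.2 hs, ?_, ?_, indicatorConstLp_coeFn, ?_⟩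
  · rw [inv_pow, hsq, inv_mul_cancel₀ h0.ne']
  · rw [norm_indicatorConstLp (by norm_num) (by norm_num), Complex.norm_real, Real.norm_eq_abs,
      abs_of_pos (inv_pos.2 hs), ENNReal.toReal_ofNat, ← Real.sqrt_eq_rpow,
      inv_mul_cancel₀ hs.ne']
  · have : l1Norm (indicatorConstLp 2 hS (measure_ne_top ν S) (((√(ν.real S))⁻¹ : ℝ) : ℂ)) =
        (√(ν.real S))⁻¹ * ν.real S := by
      have h1 : ∀ᵐ x ∂ν, ‖indicatorConstLp 2 hS (measure_ne_top ν S)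
          (((√(ν.real S))⁻¹ : ℝ) : ℂ) x‖ = S.indicator (fun _ => (√(ν.real S))⁻¹) x := by
        filter_upwards [indicatorConstLp_coeFn (p := 2) (hs := hS) (hμs := measure_ne_top ν S)
          (c := (((√(ν.real S))⁻¹ : ℝ) : ℂ))] with x hx
        rw [hx]
        by_cases hxS : x ∈ S
        · simp [hxS]
        · simp [hxS]
      rw [l1Norm, integral_congr_ae h1, integral_indicator_const _ hS, smul_eq_mul, mul_comm]
    rw [this]
    nth_rewrite 2 [← hsq]
    field_simp
    exact hsq

/-- The square of `‖g x‖` is at most `b` times `‖g x‖`. This serves to bound `A12` on indicators of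
small sets. -/
theorem norm_sq_le_mul_l1Norm {g : Lp ℂ 2 ν} {b : ℝ} (hb : ∀ᵐ x ∂ν, ‖g x‖ ≤ b) :
    ‖g‖ ^ 2 ≤ b * l1Norm g := by
  have h1 : ‖g‖ ^ 2 = ∫ x, ‖g x‖ ^ 2 ∂ν := by
    have h2 : ((‖g‖ ^ 2 : ℝ) : ℂ) = ((∫ x, ‖g x‖ ^ 2 ∂ν : ℝ) : ℂ) := by
      rw [Complex.ofReal_pow, ← Complex.coe_algebraMap, ← inner_self_eq_norm_sq_to_K (𝕜 := ℂ) g,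
        L2.inner_def, Complex.coe_algebraMap, ← integral_complex_ofReal]
      refine integral_congr_ae (Eventually.of_forall fun x => ?_)
      simp only [inner_self_eq_norm_sq_to_K, Complex.coe_algebraMap, Complex.ofReal_pow]
    exact_mod_cast h2
  rw [h1, l1Norm, ← integral_const_mul]
  refine integral_mono_of_nonneg (Eventually.of_forall fun x => by positivity)
    ((integrable_coeFn g).norm.const_mul b) ?_
  filter_upwards [hb] with x hx
  rw [sq]
  exact mul_le_mul_of_nonneg_right hx (norm_nonneg _)

/-- An integral operator on `L²` of a finite measure is compact when its kernel can be uniformly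
approximated by kernels that are simple functions of the first variable. -/
theorem isCompactOperator_of_kernel {κ : α → α → ℝ} (hκm : ∀ k, Measurable (κ k))
    (hκb : ∃ C, ∀ k s, |κ k s| ≤ C)
    (happ : ∀ ε > 0, ∃ φ : SimpleFunc α α, ∀ᵐ k ∂ν, ∀ s, |κ k s - κ (φ k) s| ≤ ε)
    (K : Lp ℂ 2 ν →L[ℂ] Lp ℂ 2 ν) (hK : ∀ f, K f =ᵐ[ν] fun k => ∫ s, (κ k s : ℂ) * f s ∂ν) :
    IsCompactOperator K := by
  obtain ⟨C, hC⟩ := hκb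
  set M : ℝ := (ν univ ^ (1 / 2 : ℝ)).toReal
  have hM : 0 ≤ M := ENNReal.toReal_nonneg
  set V : ℝ := (ν.real univ) ^ (2 : ℝ≥0∞).toReal⁻¹
  have hV : 0 ≤ V := Real.rpow_nonneg measureReal_nonneg _
  have hint : ∀ (f : Lp ℂ 2 ν) k, Integrable (fun s => (κ k s : ℂ) * f s) ν := by
    intro f k
    refine (integrable_coeFn f).bdd_mul (c := C)
      (Complex.measurable_ofReal.comp (hκm k)).aestronglyMeasurable
      (Eventually.of_forall fun s => ?_)
    rw [Complex.norm_real]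
    exact hC k s
  have hclose : ∀ ε > 0, ∃ F : Lp ℂ 2 ν →L[ℂ] Lp ℂ 2 ν, IsCompactOperator F ∧
      ‖F - K‖ ≤ V * (ε * M) := by
    intro ε hε
    obtain ⟨φ, hφ⟩ := happ ε hε
    set L : α → (Lp ℂ 2 ν →L[ℂ] ℂ) := fun y =>
      integralL2 ν ∘L mulOp ν (κ y) (hκm y) ⟨C, hC y⟩
    have hL : ∀ y f, L y f = ∫ s, (κ y s : ℂ) * f s ∂ν := fun y f =>
      integral_congr_ae (coeFn_mulOp ν (κ y) (hκm y) ⟨C, hC y⟩ f)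
    -- Freezing the first variable at the values of `φ` gives a finite sum of rank-one operators,
    -- one for each fibre of `φ`.
    set G : α → (Lp ℂ 2 ν →L[ℂ] Lp ℂ 2 ν) := fun y => (L y).smulRight
      (indicatorConstLp 2 (φ.measurableSet_fiber y) (measure_ne_top ν _) (1 : ℂ))
    have hG : ∀ y, IsCompactOperator (G y) := by
      intro y
      exact IsCompactOperator.clm_comp (isCompactOperator_of_locallyCompactSpace_dom (L y))
        (ContinuousLinearMap.toSpanSingleton ℂ
          (indicatorConstLp 2 (φ.measurableSet_fiber y) (measure_ne_top ν _) (1 : ℂ)))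
    refine ⟨∑ y ∈ φ.range, G y, ?_, ?_⟩
    · exact Submodule.sum_mem (compactOperator (RingHom.id ℂ) (Lp ℂ 2 ν) (Lp ℂ 2 ν))
        fun y _ => hG y
    · refine ContinuousLinearMap.opNorm_le_bound _ (by positivity) fun f => ?_
      rw [mul_assoc, mul_assoc]
      -- A pointwise bound by `ε * (M * ‖f‖)` suffices. The factor `V` converts a uniform bound into
      -- an `L²` bound, and `M` compares the `L¹` and `L²` norms.
      refine Lp.norm_le_of_ae_bound (by positivity) ?_
      have hval : ∀ᵐ k ∂ν, ((∑ y ∈ φ.range, G y) f : Lp ℂ 2 ν) k =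
          ∫ s, (κ (φ k) s : ℂ) * f s ∂ν := by
        have h1 : ∀ᵐ k ∂ν, ∀ y ∈ φ.range, (G y f : Lp ℂ 2 ν) k =
            (φ ⁻¹' {y}).indicator (fun _ => L y f) k := by
          rw [eventually_all_finset]
          intro y _
          filter_upwards [Lp.coeFn_smul (L y f) (indicatorConstLp 2 (φ.measurableSet_fiber y)
            (measure_ne_top ν _) (1 : ℂ)), indicatorConstLp_coeFn (p := 2)
            (hs := φ.measurableSet_fiber y) (hμs := measure_ne_top ν _) (c := (1 : ℂ))]
            with k h2 h3
          change (L y f • (indicatorConstLp 2 (φ.measurableSet_fiber y)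
            (measure_ne_top ν _) (1 : ℂ) : Lp ℂ 2 ν)) k = _
          rw [h2, Pi.smul_apply, h3]
          by_cases hk : k ∈ φ ⁻¹' {y} <;> simp [hk]
        have h4 : ((∑ y ∈ φ.range, G y) f : Lp ℂ 2 ν) =ᵐ[ν] ∑ y ∈ φ.range, ⇑(G y f) := by
          rw [_root_.sum_apply]
          exact Lp.coeFn_finsetSum _ _
        filter_upwards [h1, h4] with k h5 h6
        rw [h6, Finset.sum_apply, Finset.sum_congr rfl h5, Finset.sum_eq_single (φ k), ← hL]
        · simp
        · intro y _ hy
          rw [indicator_of_notMem]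
          exact fun h => hy h.symm
        · exact fun h => (h (φ.mem_range_self k)).elim
      filter_upwards [hφ, hval, hK f, Lp.coeFn_sub ((∑ y ∈ φ.range, G y) f) (K f)]
        with k h1 h2 h3 h4
      rw [_root_.sub_apply, h4, Pi.sub_apply, h2, h3, ← integral_sub (hint f _) (hint f _)]
      have h5 : ‖∫ s, ((κ (φ k) s : ℂ) * f s - (κ k s : ℂ) * f s) ∂ν‖ ≤ ∫ s, ε * ‖f s‖ ∂ν := by
        refine norm_integral_le_of_norm_le ((integrable_coeFn f).norm.const_mul ε)
          (Eventually.of_forall fun s => ?_)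
        rw [← sub_mul, norm_mul, ← Complex.ofReal_sub, Complex.norm_real, Real.norm_eq_abs,
          abs_sub_comm]
        exact mul_le_mul_of_nonneg_right (h1 s) (norm_nonneg _)
      refine h5.trans ?_
      rw [integral_const_mul]
      exact mul_le_mul_of_nonneg_left (l1Norm_le f) hε.le
  have hseq : ∀ n : ℕ, ∃ F : Lp ℂ 2 ν →L[ℂ] Lp ℂ 2 ν, IsCompactOperator F ∧
      ‖F - K‖ ≤ V * (1 / ((n : ℝ) + 1) * M) := fun n => hclose _ (by positivity)
  choose F hF1 hF2 using hseq
  refine isCompactOperator_of_tendsto (F := F) (l := atTop) ?_ (Eventually.of_forall hF1)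
  rw [tendsto_iff_norm_sub_tendsto_zero]
  refine squeeze_zero (fun n => norm_nonneg _) hF2 ?_
  have := ((tendsto_one_div_add_atTop_nhds_zero_nat (𝕜 := ℝ)).mul_const M).const_mul V
  simpa using this

end MulOp

/-! ### The closed cube -/

section Cube

/-- The closed cube `[-π, π]³`. -/
def closedCube : Set (Fin 3 → ℝ) := Icc (fun _ => -Real.pi) (fun _ => Real.pi)

/-- The open cube `(-π, π)³`. -/
def openCube : Set (Fin 3 → ℝ) := univ.pi fun _ => Ioo (-Real.pi) Real.pi

theorem torus_eq_pi : torus = univ.pi fun _ => Ioc (-Real.pi) Real.pi := by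
  ext k
  simp [torus]

theorem measurableSet_torus : MeasurableSet torus := by
  rw [torus_eq_pi]
  exact MeasurableSet.univ_pi fun _ => measurableSet_Ioc

theorem isCompact_closedCube : IsCompact closedCube := isCompact_Icc

theorem isPreconnected_closedCube : IsPreconnected closedCube :=
  (convex_Icc _ _).isPreconnected

theorem isOpen_openCube : IsOpen openCube := isOpen_set_pi finite_univ fun _ _ => isOpen_Ioo

theorem openCube_subset_torus : openCube ⊆ torus := by
  intro k hk i
  have := hk i (mem_univ i)
  exact ⟨this.1, this.2.le⟩

theorem torus_subset_closedCube : torus ⊆ closedCube :=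
  fun _ hk => ⟨fun i => (hk i).1.le, fun i => (hk i).2⟩

theorem closure_openCube : closure openCube = closedCube := by
  have h : (-Real.pi) ≠ Real.pi := by linarith [Real.pi_pos]
  rw [openCube, closure_pi_set]
  simp only [closure_Ioo h, closedCube, pi_univ_Icc]

theorem torusMeasure_eq_restrict_closedCube :
    torusMeasure = volume.restrict closedCube := by
  rw [torusMeasure, torus_eq_pi, closedCube]
  exact Measure.restrict_congr_set Measure.univ_pi_Ioc_ae_eq_Icc

theorem ae_mem_torus : ∀ᵐ k ∂torusMeasure, k ∈ torus := ae_restrict_mem measurableSet_torus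

theorem zero_mem_torus : (0 : Fin 3 → ℝ) ∈ torus :=
  fun _ => ⟨neg_neg_of_pos Real.pi_pos, Real.pi_pos.le⟩

theorem pi_mem_torus : (fun _ => Real.pi : Fin 3 → ℝ) ∈ torus :=
  fun _ => ⟨by linarith [Real.pi_pos], le_rfl⟩

/-- The point may lie on the boundary of the cube. Since the open cube is dense in the closed one, a
small ball around a nearby interior point works. -/
theorem exists_small_subset {U : Set (Fin 3 → ℝ)} (hU : IsOpen U) {k : Fin 3 → ℝ}
    (hk : k ∈ closedCube) (hkU : k ∈ U) {ε : ℝ} (hε : 0 < ε) :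
    ∃ S, MeasurableSet S ∧ S ⊆ U ∧ 0 < torusMeasure.real S ∧ torusMeasure.real S ≤ ε := by
  rw [← closure_openCube] at hk
  obtain ⟨q, hqU, hqO⟩ := mem_closure_iff.1 hk U hU hkU
  obtain ⟨r, hr, hball⟩ := Metric.isOpen_iff.1 (hU.inter isOpen_openCube) q ⟨hqU, hqO⟩
  -- The sup-norm ball has volume `(2ρ)³ = 8ρ³`, and this is at most `8ρ ≤ ε` because `ρ ≤ 1`.
  set ρ := min r (min 1 (ε / 8)) with hρ
  have hρ0 : 0 < ρ := by positivity
  have hsub : Metric.ball q ρ ⊆ U ∩ openCube :=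
    (Metric.ball_subset_ball (min_le_left _ _)).trans hball
  have hval : torusMeasure.real (Metric.ball q ρ) = (2 * ρ) ^ 3 := by
    rw [measureReal_def, torusMeasure, Measure.restrict_apply measurableSet_ball,
      inter_eq_left.2 (hsub.trans (inter_subset_right.trans openCube_subset_torus)),
      Real.volume_pi_ball _ hρ0, ENNReal.toReal_ofReal (by positivity), Fintype.card_fin]
  refine ⟨Metric.ball q ρ, measurableSet_ball, hsub.trans inter_subset_left, ?_, ?_⟩
  · rw [hval]
    positivity
  · rw [hval]
    have h1 : ρ ≤ 1 := (min_le_right _ _).trans (min_le_left _ _)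
    have h2 : ρ ≤ ε / 8 := (min_le_right _ _).trans (min_le_right _ _)
    have h3 : ρ ^ 3 ≤ ρ := by
      calc ρ ^ 3 = ρ * ρ ^ 2 := by ring
        _ ≤ ρ * 1 := by gcongr; exact pow_le_one₀ hρ0.le h1
        _ = ρ := mul_one ρ
    calc (2 * ρ) ^ 3 = 8 * ρ ^ 3 := by ring
      _ ≤ 8 * (ε / 8) := by gcongr; exact h3.trans h2
      _ = ε := by ring

/-- The half-open cube is not invariant under sign changes, but the closed cube is, and the two
differ by a null set. -/
theorem integral_torusMeasure_reflect {σ : Fin 3 → ℝ} (hσ : ∀ i, σ i = 1 ∨ σ i = -1)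
    (f : (Fin 3 → ℝ) → ℝ) :
    ∫ s, f (fun i => σ i * s i) ∂torusMeasure = ∫ s, f s ∂torusMeasure := by
  have hsq : ∀ i, σ i * σ i = 1 := fun i => by rcases hσ i with h | h <;> simp [h]
  have hinv : Function.Involutive (fun (s : Fin 3 → ℝ) i => σ i * s i) := by
    intro s
    funext i
    simp only [← mul_assoc, hsq, one_mul]
  have hmeas : Measurable (fun (s : Fin 3 → ℝ) i => σ i * s i) := by fun_prop
  have hvol : MeasurePreserving (fun (s : Fin 3 → ℝ) i => σ i * s i) volume volume := by
    refine volume_preserving_pi (f := fun i x => σ i * x) fun i => ?_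
    rcases hσ i with h | h
    · simp only [h, one_mul]
      exact MeasurePreserving.id volume
    · simp only [h, neg_one_mul]
      exact Measure.measurePreserving_neg volume
  have hpre : (fun (s : Fin 3 → ℝ) i => σ i * s i) ⁻¹' closedCube = closedCube := by
    ext s
    simp only [closedCube, mem_preimage, mem_Icc, Pi.le_def, ← forall_and]
    refine forall_congr' fun i => ?_
    rcases hσ i with h | h <;> rw [h]
    · simp
    · constructor <;> rintro ⟨h1, h2⟩ <;> constructor <;> linarith
  have hres := hvol.restrict_preimage (s := closedCube) measurableSet_Icc
  rw [hpre, ← torusMeasure_eq_restrict_closedCube] at hres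
  exact MeasurePreserving.integral_comp' (f := MeasurableEquiv.ofInvolutive _ hinv hmeas) hres f

end Cube

/-! ### Multiplication operators on the one-particle space -/

/-- Near a zero of `g`, normalized indicators of sets of vanishing measure are approximate null
vectors that tend to `0` in `L¹`. If `g` has no zero, compactness of the cube makes its inverse
bounded there. -/
theorem seqProper_mulOp_iff {g : (Fin 3 → ℝ) → ℝ} (hg : Continuous g) (hb : ∃ C : ℝ, ∀ x, |g x| ≤ C) :
    SeqProper (mulOp torusMeasure g hg.measurable hb) ↔ ∀ k ∈ closedCube, g k ≠ 0 := by
  constructor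
  · intro h k hk hgk
    refine not_seqProper_of_approx l1Norm continuous_l1Norm
      (fun f => eq_zero_of_l1Norm_eq_zero) (fun ε hε => ?_) h
    obtain ⟨S, hS, hSU, hS0, hSε⟩ := exists_small_subset (U := {q | |g q| < ε})
      (isOpen_lt hg.abs continuous_const) hk (by simpa [hgk] using hε) (ε := ε ^ 2) (by positivity)
    obtain ⟨f, c, -, -, hf1, hfS, hfl⟩ := exists_normalized_indicator hS hS0
    refine ⟨f, hf1, ?_, ?_⟩
    · have := norm_mulOp_le (δ := ε) hg.measurable hb (f := f) (S := S) (by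
        filter_upwards [hfS] with x hx hxS
        rw [hx, indicator_of_notMem hxS]) (fun x hx => (hSU hx).le)
      simpa [hf1] using this
    · rw [abs_of_nonneg (l1Norm_nonneg f)]
      exact le_of_sq_le_sq (hfl.trans_le hSε) hε.le
  · intro h
    obtain ⟨k, hk, hmin⟩ := isCompact_closedCube.exists_isMinOn
      ⟨0, torus_subset_closedCube zero_mem_torus⟩ hg.abs.continuousOn
    have hpos : 0 < |g k| := abs_pos.2 (h k hk)
    -- The inverse is cut off outside the cube because `g` may vanish there, while `mulOp` asks for
    -- a bound at every point.
    have hvm : Measurable (closedCube.indicator fun q => (g q)⁻¹) :=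
      hg.measurable.inv.indicator measurableSet_Icc
    have hvb : ∃ C : ℝ, ∀ x, |closedCube.indicator (fun q => (g q)⁻¹) x| ≤ C := by
      refine ⟨|g k|⁻¹, fun x => ?_⟩
      by_cases hx : x ∈ closedCube
      · rw [indicator_of_mem hx, abs_inv]
        exact inv_anti₀ hpos (hmin hx)
      · rw [indicator_of_notMem hx, abs_zero]
        positivity
    refine seqProper_of_leftInverse (mulOp torusMeasure _ hvm hvb) fun f =>
      mulOp_mulOp_of_mul_eq_one _ _ _ _ ?_ f
    filter_upwards [ae_mem_torus] with x hx
    have hx' := torus_subset_closedCube hx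
    rw [indicator_of_mem hx', inv_mul_cancel₀ (h x hx')]

/-! ### The Fredholm determinant -/

section Fredholm

theorem exists_dist_le_abs_w2_sub {z : ℝ} (hz : z ∉ Icc (0 : ℝ) 18) :
    ∃ d > 0, ∀ k p, d ≤ |w2 k p - z| := by
  rw [mem_Icc, not_and_or, not_le, not_le] at hz
  rcases hz with hz | hz
  · refine ⟨-z, by linarith, fun k p => le_trans ?_ (le_abs_self _)⟩
    linarith [(w2_mem k p).1]
  · refine ⟨z - 18, by linarith, fun k p => le_trans ?_ (neg_le_abs _)⟩
    linarith [(w2_mem k p).2]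

theorem w2_sub_ne_zero {z : ℝ} (hz : z ∉ Icc (0 : ℝ) 18) (k p : Fin 3 → ℝ) : w2 k p - z ≠ 0 := by
  obtain ⟨d, hd, h⟩ := exists_dist_le_abs_w2_sub hz
  exact abs_pos.1 (hd.trans_le (h k p))

theorem bounded_inv_w2_sub {z : ℝ} (hz : z ∉ Icc (0 : ℝ) 18) :
    ∃ C : ℝ, ∀ k p, |(w2 k p - z)⁻¹| ≤ C := by
  obtain ⟨d, hd, h⟩ := exists_dist_le_abs_w2_sub hz
  refine ⟨d⁻¹, fun k p => ?_⟩
  rw [abs_inv]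
  exact inv_anti₀ hd (h k p)

theorem measurable_w2_right (k : Fin 3 → ℝ) : Measurable (w2 k) :=
  (continuous_w2.comp (Continuous.prodMk_right k)).measurable

theorem integrable_inv_w2_sub {z : ℝ} (hz : z ∉ Icc (0 : ℝ) 18) (k : Fin 3 → ℝ) :
    Integrable (fun s => (w2 k s - z)⁻¹) torusMeasure := by
  obtain ⟨C, hC⟩ := bounded_inv_w2_sub hz
  refine (integrable_const C).mono' ?_ (Eventually.of_forall fun s => hC k s)
  exact ((measurable_w2_right k).sub_const z).inv.aestronglyMeasurable

/-- The Fredholm determinant of the generalized Friedrichs model. -/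
def fredholm (γ μ z : ℝ) (k : Fin 3 → ℝ) : ℝ :=
  w1 γ k - z - μ ^ 2 / 2 * ∫ s, (w2 k s - z)⁻¹ ∂torusMeasure

theorem continuousOn_fredholm (γ μ : ℝ) :
    ContinuousOn (fun x : (Fin 3 → ℝ) × ℝ => fredholm γ μ x.2 x.1) (univ ×ˢ (Icc (0 : ℝ) 18)ᶜ) := by
  have hw1 : Continuous (w1 γ) := continuous_eps.add continuous_const
  have hint : ContinuousOn (fun x : (Fin 3 → ℝ) × ℝ => ∫ s, (w2 x.1 s - x.2)⁻¹ ∂torusMeasure)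
      (univ ×ˢ (Icc (0 : ℝ) 18)ᶜ) := by
    rintro ⟨k, z⟩ ⟨-, hz⟩
    obtain ⟨d, hd, h⟩ := exists_dist_le_abs_w2_sub hz
    refine ContinuousAt.continuousWithinAt ?_
    -- Moving `z` by less than `d / 2` keeps it at distance at least `d / 2` from all values of
    -- `w2`.
    refine continuousAt_of_dominated (bound := fun _ => (d / 2)⁻¹) ?_ ?_ (integrable_const _) ?_
    · exact Eventually.of_forall fun x =>
        ((measurable_w2_right x.1).sub_const x.2).inv.aestronglyMeasurable
    · have hnear : ∀ᶠ x : (Fin 3 → ℝ) × ℝ in 𝓝 (k, z), |x.2 - z| < d / 2 := by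
        have : Tendsto (fun x : (Fin 3 → ℝ) × ℝ => |x.2 - z|) (𝓝 (k, z)) (𝓝 0) := by
          have hc : Continuous fun x : (Fin 3 → ℝ) × ℝ => |x.2 - z| := by fun_prop
          simpa using hc.tendsto (k, z)
        exact this.eventually_lt_const (by positivity)
      filter_upwards [hnear] with x hx
      refine Eventually.of_forall fun s => ?_
      rw [Real.norm_eq_abs, abs_inv]
      refine inv_anti₀ (by positivity) ?_
      have h1 := h x.1 s
      have h2 := abs_sub_abs_le_abs_sub (w2 x.1 s - z) (x.2 - z)
      have h3 : w2 x.1 s - z - (x.2 - z) = w2 x.1 s - x.2 := by ring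
      rw [h3] at h2
      linarith
    · refine Eventually.of_forall fun s => ?_
      refine ContinuousAt.inv₀ ?_ (w2_sub_ne_zero hz k s)
      have hc : Continuous fun x : (Fin 3 → ℝ) × ℝ => w2 x.1 s - x.2 :=
        (continuous_w2.comp (continuous_fst.prodMk continuous_const)).sub continuous_snd
      exact hc.continuousAt
  have h1 : Continuous fun x : (Fin 3 → ℝ) × ℝ => w1 γ x.1 - x.2 := by fun_prop
  exact h1.continuousOn.sub (continuousOn_const.mul hint)

theorem continuous_fredholm (γ μ : ℝ) {z : ℝ} (hz : z ∉ Icc (0 : ℝ) 18) :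
    Continuous (fredholm γ μ z) := by
  rw [← continuousOn_univ]
  exact (continuousOn_fredholm γ μ).comp (f := fun k => (k, z)) (by fun_prop)
    fun k _ => ⟨mem_univ _, hz⟩

theorem bounded_fredholm (γ μ : ℝ) {z : ℝ} (hz : z ∉ Icc (0 : ℝ) 18) :
    ∃ C : ℝ, ∀ k, |fredholm γ μ z k| ≤ C := by
  obtain ⟨C, hC⟩ := bounded_inv_w2_sub hz
  obtain ⟨C', hC'⟩ := bounded_w1 γ
  refine ⟨C' + |z| + μ ^ 2 / 2 * (C * torusMeasure.real univ), fun k => ?_⟩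
  refine (abs_sub _ _).trans (add_le_add ((abs_sub _ _).trans (add_le_add (hC' k) le_rfl)) ?_)
  rw [abs_mul, abs_of_nonneg (by positivity : 0 ≤ μ ^ 2 / 2)]
  gcongr
  exact norm_integral_le_of_norm_le_const (f := fun s => (w2 k s - z)⁻¹) (Eventually.of_forall fun s => hC k s)

/-- On either side of the band `(w2 - z)⁻¹` increases with `z`, so the integral term only adds to
the decrease coming from `-z`. -/
theorem fredholm_add_sub_le (γ μ : ℝ) {z z' : ℝ} (h : z < z') (hside : z' < 0 ∨ 18 < z)
    (k : Fin 3 → ℝ) : fredholm γ μ z' k + (z' - z) ≤ fredholm γ μ z k := by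
  have hz : z ∉ Icc (0 : ℝ) 18 := fun hh => by rcases hside with h' | h' <;> linarith [hh.1, hh.2]
  have hz' : z' ∉ Icc (0 : ℝ) 18 := fun hh => by rcases hside with h' | h' <;> linarith [hh.1, hh.2]
  have hint : ∫ s, (w2 k s - z)⁻¹ ∂torusMeasure ≤ ∫ s, (w2 k s - z')⁻¹ ∂torusMeasure := by
    refine integral_mono (integrable_inv_w2_sub hz k) (integrable_inv_w2_sub hz' k) fun s => ?_
    have hw := w2_mem k s
    rcases hside with h' | h'
    · exact inv_anti₀ (by linarith [hw.1]) (by linarith)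
    · exact (inv_le_inv_of_neg (by linarith [hw.2]) (by linarith [hw.2])).2 (by linarith)
  have := mul_le_mul_of_nonneg_left hint (by positivity : 0 ≤ μ ^ 2 / 2)
  unfold fredholm
  linarith

theorem eps_zero : eps 0 = 0 := by simp [eps]

theorem eps_pi : eps (fun _ => Real.pi) = 6 := by
  simp [eps]
  norm_num

theorem eps_half_le {s : Fin 3 → ℝ} (hs : s ∈ torus) : eps ((1 / 2 : ℝ) • s) ≤ 3 := by
  have h : ∀ i, 0 ≤ Real.cos (((1 / 2 : ℝ) • s) i) := by
    intro i
    refine Real.cos_nonneg_of_mem_Icc ⟨?_, ?_⟩ <;>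
    · simp only [Pi.smul_apply, smul_eq_mul]
      linarith [(hs i).1, (hs i).2]
  simp only [eps, Fin.sum_univ_three]
  linarith [h 0, h 1, h 2]

/-- For `s` in the torus all `s i / 2` lie in `[-π/2, π/2]`, so `eps (s / 2) ≤ 3 < 6` and `w2 0 s`
is at most `w2` at the corner. The integral terms then compare in the right direction, and `w1`
contributes the strict gap `6`. This makes `fredholm` non-constant in `k`. -/
theorem fredholm_zero_lt_pi (γ μ : ℝ) {z : ℝ} (hz : z ∉ Icc (0 : ℝ) 18) :
    fredholm γ μ z 0 < fredholm γ μ z (fun _ => Real.pi) := by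
  have hint : ∫ s, (w2 (fun _ => Real.pi) s - z)⁻¹ ∂torusMeasure ≤
      ∫ s, (w2 0 s - z)⁻¹ ∂torusMeasure := by
    refine integral_mono_ae (integrable_inv_w2_sub hz _) (integrable_inv_w2_sub hz _) ?_
    filter_upwards [ae_mem_torus] with s hs
    have h0 : w2 0 s ≤ w2 (fun _ => Real.pi) s := by
      unfold w2
      rw [eps_zero, eps_pi, zero_add, zero_add]
      linarith [eps_half_le hs, (eps_mem ((1 / 2 : ℝ) • ((fun _ => Real.pi) + s))).1]
    have ha := w2_mem 0 s
    have hb := w2_mem (fun _ => Real.pi) s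
    rw [mem_Icc, not_and_or, not_le, not_le] at hz
    rcases hz with hz | hz
    · exact inv_anti₀ (by linarith [ha.1]) (by linarith)
    · exact (inv_le_inv_of_neg (by linarith [hb.2]) (by linarith [ha.2])).2 (by linarith)
  have := mul_le_mul_of_nonneg_left hint (by positivity : 0 ≤ μ ^ 2 / 2)
  unfold fredholm w1
  rw [eps_zero, eps_pi]
  linarith

theorem eps_reflect {σ : Fin 3 → ℝ} (hσ : ∀ i, σ i = 1 ∨ σ i = -1) (k : Fin 3 → ℝ) :
    eps (fun i => σ i * k i) = eps k := by
  unfold eps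
  refine Finset.sum_congr rfl fun i _ => ?_
  rcases hσ i with h | h <;> simp [h]

theorem w2_reflect {σ : Fin 3 → ℝ} (hσ : ∀ i, σ i = 1 ∨ σ i = -1) (k p : Fin 3 → ℝ) :
    w2 (fun i => σ i * k i) (fun i => σ i * p i) = w2 k p := by
  have h : (1 / 2 : ℝ) • ((fun i => σ i * k i) + fun i => σ i * p i) =
      fun i => σ i * ((1 / 2 : ℝ) • (k + p)) i := by
    funext i
    simp only [Pi.smul_apply, Pi.add_apply, smul_eq_mul]
    ring
  unfold w2
  rw [h, eps_reflect hσ, eps_reflect hσ, eps_reflect hσ]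

theorem fredholm_reflect (γ μ z : ℝ) {σ : Fin 3 → ℝ} (hσ : ∀ i, σ i = 1 ∨ σ i = -1)
    (k : Fin 3 → ℝ) : fredholm γ μ z (fun i => σ i * k i) = fredholm γ μ z k := by
  unfold fredholm w1
  rw [eps_reflect hσ, ← integral_torusMeasure_reflect hσ]
  simp only [w2_reflect hσ]

/-- The parts of the boundary of the cube outside the torus do not contribute new zeros. -/
theorem exists_torus_fredholm_iff (γ μ z : ℝ) :
    (∃ k ∈ torus, fredholm γ μ z k = 0) ↔ ∃ k ∈ closedCube, fredholm γ μ z k = 0 := by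
  constructor
  · rintro ⟨k, hk, h⟩
    exact ⟨k, torus_subset_closedCube hk, h⟩
  · rintro ⟨k, hk, h⟩
    classical
    -- Only the coordinates equal to `-π` change sign, which moves them to `π` inside the torus.
    have hσ : ∀ i, (if k i = -Real.pi then (-1 : ℝ) else 1) = 1 ∨
        (if k i = -Real.pi then (-1 : ℝ) else 1) = -1 := by
      intro i
      split_ifs <;> simp
    refine ⟨fun i => (if k i = -Real.pi then (-1 : ℝ) else 1) * k i, fun i => ?_, ?_⟩
    · by_cases hi : k i = -Real.pi
      · simp only [hi, if_true, neg_one_mul, neg_neg]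
        exact ⟨by linarith [Real.pi_pos], le_rfl⟩
      · simp only [hi, if_false, one_mul]
        exact ⟨lt_of_le_of_ne (hk.1 i) (Ne.symm hi), hk.2 i⟩
    · rw [fredholm_reflect γ μ z hσ, h]

end Fredholm

/-! ### Approximation of the kernel `(w₂ - z)⁻¹` -/

section Kernel

theorem abs_eps_sub_le (k q : Fin 3 → ℝ) : |eps k - eps q| ≤ 3 * dist k q := by
  have h : ∀ i, |Real.cos (k i) - Real.cos (q i)| ≤ dist k q := fun i =>
    (Real.abs_cos_sub_cos_le _ _).trans (dist_le_pi_dist k q i)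
  have h' := fun i => abs_le.1 (h i)
  simp only [eps, Fin.sum_univ_three]
  rw [abs_le]
  constructor <;> linarith [h' 0, h' 1, h' 2]

theorem abs_w2_sub_le (k q s : Fin 3 → ℝ) : |w2 k s - w2 q s| ≤ 6 * dist k q := by
  have h1 := abs_le.1 (abs_eps_sub_le k q)
  have h2 := abs_le.1 (abs_eps_sub_le ((1 / 2 : ℝ) • (k + s)) ((1 / 2 : ℝ) • (q + s)))
  have h3 : dist ((1 / 2 : ℝ) • (k + s)) ((1 / 2 : ℝ) • (q + s)) ≤ dist k q := by
    rw [dist_smul₀, dist_add_right, Real.norm_eq_abs, abs_of_pos (by norm_num)]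
    linarith [dist_nonneg (x := k) (y := q)]
  unfold w2
  rw [abs_le]
  constructor <;> linarith [h1.1, h1.2, h2.1, h2.2]

theorem exists_lipschitz_inv_w2_sub {z : ℝ} (hz : z ∉ Icc (0 : ℝ) 18) :
    ∃ L > 0, ∀ k q s, |(w2 k s - z)⁻¹ - (w2 q s - z)⁻¹| ≤ L * dist k q := by
  obtain ⟨d, hd, h⟩ := exists_dist_le_abs_w2_sub hz
  refine ⟨6 / (d * d), by positivity, fun k q s => ?_⟩
  have hk := w2_sub_ne_zero hz k s
  have hq := w2_sub_ne_zero hz q s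
  rw [inv_sub_inv hk hq, abs_div, abs_mul, div_mul_eq_mul_div]
  have h1 : |w2 q s - z - (w2 k s - z)| ≤ 6 * dist k q := by
    rw [sub_sub_sub_cancel_right, dist_comm]
    exact abs_w2_sub_le q k s
  gcongr
  · exact h k s
  · exact h q s

/-- Finitely many `δ`-balls around points of a dense sequence cover the cube, and `φ` picks the
nearest point among indices up to the largest one used. -/
theorem exists_simpleFunc_dist_lt {δ : ℝ} (hδ : 0 < δ) :
    ∃ φ : SimpleFunc (Fin 3 → ℝ) (Fin 3 → ℝ), ∀ k ∈ closedCube, dist (φ k) k < δ := by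
  set e := TopologicalSpace.denseSeq (Fin 3 → ℝ)
  obtain ⟨t, ht⟩ := isCompact_closedCube.elim_finite_subcover (fun n => Metric.ball (e n) δ)
    (fun n => Metric.isOpen_ball) (fun k _ => by
      obtain ⟨n, hn⟩ := (TopologicalSpace.denseRange_denseSeq (Fin 3 → ℝ)).exists_dist_lt k hδ
      exact mem_iUnion.2 ⟨n, hn⟩)
  refine ⟨SimpleFunc.nearestPt e (t.sup id), fun k hk => ?_⟩
  obtain ⟨n, hn, hkn⟩ := mem_iUnion₂.1 (ht hk)
  have h1 := SimpleFunc.edist_nearestPt_le e k (Finset.le_sup (f := id) hn)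
  rw [edist_dist, edist_dist, ENNReal.ofReal_le_ofReal_iff dist_nonneg] at h1
  refine h1.trans_lt ?_
  rw [dist_comm]
  exact hkn

theorem isCompactOperator_inv_w2_kernel {z : ℝ} (hz : z ∉ Icc (0 : ℝ) 18) (c : ℝ) (K : H1 →L[ℂ] H1)
    (hK : ∀ f, K f =ᵐ[torusMeasure]
      fun k => ∫ s, ((c * (w2 k s - z)⁻¹ : ℝ) : ℂ) * f s ∂torusMeasure) :
    IsCompactOperator K := by
  obtain ⟨C, hC⟩ := bounded_inv_w2_sub hz
  obtain ⟨L, hL, hlip⟩ := exists_lipschitz_inv_w2_sub hz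
  refine isCompactOperator_of_kernel (κ := fun k s => c * (w2 k s - z)⁻¹) (fun k => ?_)
    ⟨|c| * C, fun k s => ?_⟩ (fun ε hε => ?_) K hK
  · exact ((measurable_w2_right k).sub_const z).inv.const_mul c
  · rw [abs_mul]
    gcongr
    exact hC k s
  · obtain ⟨φ, hφ⟩ := exists_simpleFunc_dist_lt (δ := ε / ((|c| + 1) * L)) (by positivity)
    refine ⟨φ, ?_⟩
    filter_upwards [ae_mem_torus] with k hk s
    rw [← mul_sub, abs_mul]
    have h1 : |(w2 k s - z)⁻¹ - (w2 (φ k) s - z)⁻¹| ≤ L * (ε / ((|c| + 1) * L)) := by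
      refine (hlip _ _ _).trans ?_
      rw [dist_comm]
      gcongr
      exact (hφ k (torus_subset_closedCube hk)).le
    calc |c| * |(w2 k s - z)⁻¹ - (w2 (φ k) s - z)⁻¹|
        ≤ (|c| + 1) * (L * (ε / ((|c| + 1) * L))) := by
          gcongr
          linarith
      _ = ε := by field_simp

end Kernel

/-! ### The adjoints of the annihilation operators -/

theorem coeFn_adjoint_A01 (c : ℂ) :
    ContinuousLinearMap.adjoint A01 c =ᵐ[torusMeasure] fun _ => c := by
  have h : ContinuousLinearMap.adjoint A01 c = Lp.const 2 torusMeasure c := by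
    refine ext_inner_left ℂ fun f => ?_
    rw [ContinuousLinearMap.adjoint_inner_right, L2.inner_def]
    have h1 : ∀ᵐ t ∂torusMeasure, inner ℂ (f t) ((Lp.const 2 torusMeasure c : H1) t) =
        c * (starRingEnd ℂ) (f t) := by
      filter_upwards [Lp.coeFn_const 2 torusMeasure c] with t ht
      rw [ht]
      simp [RCLike.inner_apply]
    rw [integral_congr_ae h1, integral_const_mul, integral_conj]
    rfl
  rw [h]
  exact Lp.coeFn_const _ _ c

/-- On all of `L2Pair` the adjoint would be `f x.1`. Restricting to symmetric functions replaces it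
by its symmetrization, whence the factor `1/2` that matches `μ / √2` in the Friedrichs model. -/
theorem coeFn_adjoint_A12 (f : H1) :
    ((ContinuousLinearMap.adjoint A12 f : H2) : L2Pair) =ᵐ[torusMeasure.prod torusMeasure]
      fun x => (f x.1 + f x.2) / 2 := by
  have h1 : MemLp (fun x : (Fin 3 → ℝ) × (Fin 3 → ℝ) => f x.1) 2
      (torusMeasure.prod torusMeasure) := (Lp.memLp f).comp_fst torusMeasure
  have h2 : MemLp (fun x : (Fin 3 → ℝ) × (Fin 3 → ℝ) => f x.2) 2
      (torusMeasure.prod torusMeasure) := (Lp.memLp f).comp_snd torusMeasure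
  have h3 : MemLp (fun x : (Fin 3 → ℝ) × (Fin 3 → ℝ) => (f x.1 + f x.2) / 2) 2
      (torusMeasure.prod torusMeasure) := by
    simpa only [div_eq_inv_mul, Pi.add_apply] using (h1.add h2).const_mul (2⁻¹ : ℂ)
  have hswap := (Measure.measurePreserving_swap
    (μ := torusMeasure) (ν := torusMeasure)).quasiMeasurePreserving
  have hg : h3.toLp _ ∈ symmetricSubspace := by
    change ∀ᵐ x ∂(torusMeasure.prod torusMeasure), h3.toLp _ (x.2, x.1) = h3.toLp _ x
    filter_upwards [h3.coeFn_toLp, hswap.ae h3.coeFn_toLp] with x hx hx'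
    have hx'' : h3.toLp _ (x.2, x.1) = (f x.2 + f x.1) / 2 := hx'
    rw [hx, hx'', add_comm]
  have key : ContinuousLinearMap.adjoint A12 f = (⟨h3.toLp _, hg⟩ : H2) := by
    refine ext_inner_left ℂ fun u => ?_
    rw [ContinuousLinearMap.adjoint_inner_right, Submodule.coe_inner, L2.inner_def, L2.inner_def]
    have hu : Integrable (fun x => inner ℂ (u.1 x) (f x.1)) (torusMeasure.prod torusMeasure) := by
      refine (L2.integrable_inner (𝕜 := ℂ) u.1 (h1.toLp _)).congr ?_
      filter_upwards [h1.coeFn_toLp] with x hx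
      rw [hx]
    have hu' : Integrable (fun x => inner ℂ (u.1 x) (f x.2)) (torusMeasure.prod torusMeasure) := by
      refine (L2.integrable_inner (𝕜 := ℂ) u.1 (h2.toLp _)).congr ?_
      filter_upwards [h2.coeFn_toLp] with x hx
      rw [hx]
    have e1 : ∫ k, inner ℂ (A12 u k) (f k) ∂torusMeasure =
        ∫ x, inner ℂ (u.1 x) (f x.1) ∂(torusMeasure.prod torusMeasure) := by
      rw [integral_prod _ hu]
      refine integral_congr_ae ?_
      filter_upwards [coeFn_partialIntegral torusMeasure torusMeasure u.1] with k hk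
      have hk' : A12 u k = ∫ s, u.1 (k, s) ∂torusMeasure := hk
      simp only [RCLike.inner_apply]
      rw [hk', integral_const_mul, integral_conj]
    have e2 : ∫ x, inner ℂ (u.1 x) (f x.2) ∂(torusMeasure.prod torusMeasure) =
        ∫ x, inner ℂ (u.1 x) (f x.1) ∂(torusMeasure.prod torusMeasure) := by
      rw [← integral_prod_swap]
      refine integral_congr_ae ?_
      filter_upwards [u.2] with x hx
      change inner ℂ (u.1 (x.2, x.1)) (f x.1) = _
      rw [hx]
    have e3 : ∫ x, inner ℂ (u.1 x) (h3.toLp _ x) ∂(torusMeasure.prod torusMeasure) =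
        ∫ x, (2⁻¹ : ℂ) * (inner ℂ (u.1 x) (f x.1) + inner ℂ (u.1 x) (f x.2))
          ∂(torusMeasure.prod torusMeasure) := by
      refine integral_congr_ae ?_
      filter_upwards [h3.coeFn_toLp] with x hx
      rw [hx]
      simp only [RCLike.inner_apply]
      ring
    rw [e1]
    refine Eq.trans ?_ e3.symm
    rw [integral_const_mul, integral_add hu hu', e2]
    ring
  rw [key]
  exact h3.coeFn_toLp

/-! ### Schur complements -/

section Schur

variable {z : ℝ}

theorem bounded_inv_w2_sub_right (hz : z ∉ Icc (0 : ℝ) 18) (k : Fin 3 → ℝ) :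
    ∃ C : ℝ, ∀ s, |(w2 k s - z)⁻¹| ≤ C :=
  (bounded_inv_w2_sub hz).imp fun _ h s => h k s

theorem bounded_inv_w2_sub_pair (hz : z ∉ Icc (0 : ℝ) 18) :
    ∃ C : ℝ, ∀ x : (Fin 3 → ℝ) × (Fin 3 → ℝ), |(w2 x.1 x.2 - z)⁻¹| ≤ C :=
  (bounded_inv_w2_sub hz).imp fun _ h x => h x.1 x.2

theorem bounded_sub_const {α : Type*} {w : α → ℝ} (h : ∃ C : ℝ, ∀ x, |w x| ≤ C) (c : ℝ) :
    ∃ C : ℝ, ∀ x, |w x - c| ≤ C := by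
  obtain ⟨C, hC⟩ := h
  exact ⟨C + |c|, fun x => (abs_sub _ _).trans (add_le_add (hC x) le_rfl)⟩

/-- The inverse of `A₁₁(k) - z`. -/
def resolventA11At (k : Fin 3 → ℝ) (hz : z ∉ Icc (0 : ℝ) 18) : H1 →L[ℂ] H1 :=
  mulOp torusMeasure (fun s => (w2 k s - z)⁻¹) ((measurable_w2_right k).sub_const z).inv
    (bounded_inv_w2_sub_right hz k)

theorem A11At_sub (k : Fin 3 → ℝ) :
    A11At k - algebraMap ℂ (H1 →L[ℂ] H1) z = mulOp torusMeasure (fun s => w2 k s - z)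
      ((measurable_w2_right k).sub_const z) (bounded_sub_const ⟨18, abs_w2_le k⟩ z) :=
  mulOp_sub_algebraMap _ _ _ _ _

theorem A11At_sub_resolvent (k : Fin 3 → ℝ) (hz : z ∉ Icc (0 : ℝ) 18) (f : H1) :
    (A11At k - algebraMap ℂ (H1 →L[ℂ] H1) z) (resolventA11At k hz f) = f := by
  rw [A11At_sub]
  exact mulOp_mulOp_of_mul_eq_one _ _ _ _
    (Eventually.of_forall fun s => mul_inv_cancel₀ (w2_sub_ne_zero hz k s)) f

theorem resolvent_A11At_sub (k : Fin 3 → ℝ) (hz : z ∉ Icc (0 : ℝ) 18) (f : H1) :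
    resolventA11At k hz ((A11At k - algebraMap ℂ (H1 →L[ℂ] H1) z) f) = f := by
  rw [A11At_sub]
  exact mulOp_mulOp_of_mul_eq_one _ _ _ _
    (Eventually.of_forall fun s => inv_mul_cancel₀ (w2_sub_ne_zero hz k s)) f

/-- Multiplication by `(w₂ - z)⁻¹` on `L₂((T³)²)`. -/
def mulInvW2 (hz : z ∉ Icc (0 : ℝ) 18) : L2Pair →L[ℂ] L2Pair :=
  mulOp (torusMeasure.prod torusMeasure) (fun x => (w2 x.1 x.2 - z)⁻¹)
    (continuous_w2.measurable.sub_const z).inv (bounded_inv_w2_sub_pair hz)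

theorem mulInvW2_mem (hz : z ∉ Icc (0 : ℝ) 18) (f : H2) : mulInvW2 hz f ∈ symmetricSubspace := by
  have h : mulInvW2 hz f =ᵐ[torusMeasure.prod torusMeasure]
      fun x => (((w2 x.1 x.2 - z)⁻¹ : ℝ) : ℂ) * f.1 x := coeFn_mulOp _ _ _ _ _
  have hf : ∀ᵐ x ∂(torusMeasure.prod torusMeasure), f.1 (x.2, x.1) = f.1 x := f.2
  change ∀ᵐ x ∂(torusMeasure.prod torusMeasure), mulInvW2 hz f (x.2, x.1) = mulInvW2 hz f x
  filter_upwards [h, (Measure.measurePreserving_swap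
    (μ := torusMeasure) (ν := torusMeasure)).quasiMeasurePreserving.ae h, hf] with x h1 h2 h3
  have h2' : mulInvW2 hz f (x.2, x.1) = (((w2 x.2 x.1 - z)⁻¹ : ℝ) : ℂ) * f.1 (x.2, x.1) := h2
  rw [h2', h1, h3, w2_comm]

/-- The inverse of `A₂₂ - z`. -/
def resolventA22 (hz : z ∉ Icc (0 : ℝ) 18) : H2 →L[ℂ] H2 :=
  (mulInvW2 hz ∘L symmetricSubspace.subtypeL).codRestrict symmetricSubspace (mulInvW2_mem hz)

theorem coe_A22_sub (z : ℝ) (f : H2) :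
    (((A22 - algebraMap ℂ (H2 →L[ℂ] H2) z) f : H2) : L2Pair) =
      mulOp (torusMeasure.prod torusMeasure) (fun x => w2 x.1 x.2 - z)
        (continuous_w2.measurable.sub_const z)
        (bounded_sub_const (w := fun x : (Fin 3 → ℝ) × (Fin 3 → ℝ) => w2 x.1 x.2)
          ⟨18, fun x => abs_w2_le x.1 x.2⟩ z) f.1 := by
  have h1 : (((A22 - algebraMap ℂ (H2 →L[ℂ] H2) z) f : H2) : L2Pair) =
      mulW2 f.1 - (z : ℂ) • f.1 := by
    rw [_root_.sub_apply, Algebra.algebraMap_eq_smul_one]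
    rfl
  have h2 : (mulW2 - algebraMap ℂ (L2Pair →L[ℂ] L2Pair) z) f.1 = mulW2 f.1 - (z : ℂ) • f.1 := by
    rw [_root_.sub_apply, Algebra.algebraMap_eq_smul_one]
    rfl
  rw [h1, ← h2, mulW2, mulOp_sub_algebraMap]

theorem A22_sub_resolvent (hz : z ∉ Icc (0 : ℝ) 18) (f : H2) :
    (A22 - algebraMap ℂ (H2 →L[ℂ] H2) z) (resolventA22 hz f) = f := by
  refine Subtype.ext ?_
  rw [coe_A22_sub]
  exact mulOp_mulOp_of_mul_eq_one (v := fun x : (Fin 3 → ℝ) × (Fin 3 → ℝ) => w2 x.1 x.2 - z)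
    (w := fun x : (Fin 3 → ℝ) × (Fin 3 → ℝ) => (w2 x.1 x.2 - z)⁻¹) _ _
    (continuous_w2.measurable.sub_const z).inv (bounded_inv_w2_sub_pair hz)
    (Eventually.of_forall fun x => mul_inv_cancel₀ (w2_sub_ne_zero hz x.1 x.2)) f.1

theorem resolvent_A22_sub (hz : z ∉ Icc (0 : ℝ) 18) (f : H2) :
    resolventA22 hz ((A22 - algebraMap ℂ (H2 →L[ℂ] H2) z) f) = f := by
  refine Subtype.ext ?_
  change mulInvW2 hz ((A22 - algebraMap ℂ (H2 →L[ℂ] H2) z) f : H2).1 = f.1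
  rw [coe_A22_sub]
  exact mulOp_mulOp_of_mul_eq_one (v := fun x : (Fin 3 → ℝ) × (Fin 3 → ℝ) => (w2 x.1 x.2 - z)⁻¹)
    (w := fun x : (Fin 3 → ℝ) × (Fin 3 → ℝ) => w2 x.1 x.2 - z) _ _ _ _
    (Eventually.of_forall fun x => inv_mul_cancel₀ (w2_sub_ne_zero hz x.1 x.2)) f.1

/-- The two terms of the symmetrization separate: `f x.1` leaves the integral and gives a
multiplication operator, while `f x.2` gives an integral operator. -/
theorem coeFn_A12_resolvent_adjoint (hz : z ∉ Icc (0 : ℝ) 18) (f : H1) :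
    A12 (resolventA22 hz (ContinuousLinearMap.adjoint A12 f)) =ᵐ[torusMeasure] fun k =>
      (1 / 2 : ℂ) * (((∫ s, (w2 k s - z)⁻¹ ∂torusMeasure : ℝ) : ℂ) * f k +
        ∫ s, (((w2 k s - z)⁻¹ : ℝ) : ℂ) * f s ∂torusMeasure) := by
  set g : H2 := resolventA22 hz (ContinuousLinearMap.adjoint A12 f)
  have h1 : g.1 =ᵐ[torusMeasure.prod torusMeasure]
      fun x => (((w2 x.1 x.2 - z)⁻¹ : ℝ) : ℂ) * ((f x.1 + f x.2) / 2) := by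
    have h2 : g.1 =ᵐ[torusMeasure.prod torusMeasure] fun x => (((w2 x.1 x.2 - z)⁻¹ : ℝ) : ℂ) *
        (ContinuousLinearMap.adjoint A12 f : H2).1 x :=
      coeFn_mulOp _ _ (continuous_w2.measurable.sub_const z).inv (bounded_inv_w2_sub_pair hz) _
    filter_upwards [h2, coeFn_adjoint_A12 f] with x h3 h4
    rw [h3, h4]
  obtain ⟨C, hC⟩ := bounded_inv_w2_sub hz
  filter_upwards [coeFn_partialIntegral torusMeasure torusMeasure g.1,
    Measure.ae_ae_of_ae_prod h1] with k h2 h3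
  have h2' : A12 g k = ∫ s, g.1 (k, s) ∂torusMeasure := h2
  rw [h2', integral_congr_ae h3]
  have hi1 : Integrable (fun s => (((w2 k s - z)⁻¹ : ℝ) : ℂ) * f k) torusMeasure :=
    (integrable_inv_w2_sub hz k).ofReal.mul_const (f k)
  have hi2 : Integrable (fun s => (((w2 k s - z)⁻¹ : ℝ) : ℂ) * f s) torusMeasure := by
    refine (integrable_coeFn f).bdd_mul (c := C) (Complex.measurable_ofReal.comp
      ((measurable_w2_right k).sub_const z).inv).aestronglyMeasurable
      (Eventually.of_forall fun s => ?_)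
    rw [Complex.norm_real]
    exact hC k s
  have h4 : ∀ s, (((w2 k s - z)⁻¹ : ℝ) : ℂ) * ((f k + f s) / 2) =
      (1 / 2 : ℂ) * ((((w2 k s - z)⁻¹ : ℝ) : ℂ) * f k + (((w2 k s - z)⁻¹ : ℝ) : ℂ) * f s) := by
    intro s
    ring
  simp only [h4]
  rw [integral_const_mul, integral_add hi1 hi2, integral_mul_const, integral_complex_ofReal]

theorem A01_resolvent_adjoint (k : Fin 3 → ℝ) (hz : z ∉ Icc (0 : ℝ) 18) (c : ℂ) :
    A01 (resolventA11At k hz (ContinuousLinearMap.adjoint A01 c)) =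
      ((∫ s, (w2 k s - z)⁻¹ ∂torusMeasure : ℝ) : ℂ) * c := by
  change ∫ s, resolventA11At k hz (ContinuousLinearMap.adjoint A01 c) s ∂torusMeasure = _
  have h : resolventA11At k hz (ContinuousLinearMap.adjoint A01 c) =ᵐ[torusMeasure]
      fun s => (((w2 k s - z)⁻¹ : ℝ) : ℂ) * c := by
    have h1 : resolventA11At k hz (ContinuousLinearMap.adjoint A01 c) =ᵐ[torusMeasure]
      fun s => (((w2 k s - z)⁻¹ : ℝ) : ℂ) * ContinuousLinearMap.adjoint A01 c s :=
        coeFn_mulOp _ _ _ _ _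
    filter_upwards [h1, coeFn_adjoint_A01 c] with s h2 h3
    rw [h2, h3]
  rw [integral_congr_ae h, integral_mul_const, integral_complex_ofReal]

end Schur

/-! ### Self-adjointness -/

theorem adjoint_real_smul {E F : Type*} [NormedAddCommGroup E] [InnerProductSpace ℂ E]
    [CompleteSpace E] [NormedAddCommGroup F] [InnerProductSpace ℂ F] [CompleteSpace F] (c : ℝ)
    (T : E →L[ℂ] F) : ContinuousLinearMap.adjoint ((c : ℂ) • T) =
      (c : ℂ) • ContinuousLinearMap.adjoint T := by
  rw [map_smulₛₗ, Complex.conj_ofReal]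

theorem isSelfAdjoint_A22 : IsSelfAdjoint A22 := by
  rw [ContinuousLinearMap.isSelfAdjoint_iff']
  symm
  rw [ContinuousLinearMap.eq_adjoint_iff]
  intro f g
  have h : IsSelfAdjoint mulW2 := isSelfAdjoint_mulOp _ _
  rw [ContinuousLinearMap.isSelfAdjoint_iff'] at h
  change inner ℂ (mulW2 f.1) g.1 = inner ℂ f.1 (mulW2 g.1)
  rw [← ContinuousLinearMap.adjoint_inner_left, h]

theorem isSelfAdjoint_opA (γ μ : ℝ) : IsSelfAdjoint (opA γ μ) := by
  rw [opA, ← adjoint_real_smul]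
  exact isSelfAdjoint_blockMatrix (isSelfAdjoint_mulOp _ _) isSelfAdjoint_A22

theorem isSelfAdjoint_friedrichs (γ μ : ℝ) (k : Fin 3 → ℝ) : IsSelfAdjoint (friedrichs γ μ k) := by
  rw [friedrichs, ← adjoint_real_smul]
  refine isSelfAdjoint_blockMatrix ?_ (isSelfAdjoint_mulOp _ _)
  rw [ContinuousLinearMap.isSelfAdjoint_iff', A00, adjoint_real_smul,
    ContinuousLinearMap.adjoint_id]

/-! ### The essential spectrum outside `[0, 18]` -/

/-- The Schur complement `S` equals multiplication by `fredholm γ μ z` up to an integral operator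
with kernel `-(μ ^ 2 / 2) * (w2 k s - z)⁻¹`, which is compact. -/
theorem seqProper_opA_sub_iff (γ μ : ℝ) {z : ℝ} (hz : z ∉ Icc (0 : ℝ) 18) :
    SeqProper (opA γ μ - algebraMap ℂ _ (z : ℂ)) ↔ ∀ k ∈ closedCube, fredholm γ μ z k ≠ 0 := by
  rw [opA, blockMatrix_sub_algebraMap,
    seqProper_blockMatrix_iff (A22_sub_resolvent hz) (resolvent_A22_sub hz),
    ← seqProper_mulOp_iff (continuous_fredholm γ μ hz) (bounded_fredholm γ μ hz)]
  set S : H1 →L[ℂ] H1 := A11 γ - algebraMap ℂ (H1 →L[ℂ] H1) z -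
    ((μ : ℂ) • A12) ∘L resolventA22 hz ∘L ((μ : ℂ) • ContinuousLinearMap.adjoint A12) with hS
  set D : H1 →L[ℂ] H1 := mulOp torusMeasure (fredholm γ μ z) (continuous_fredholm γ μ hz).measurable
    (bounded_fredholm γ μ hz) with hD
  have hcomp : IsCompactOperator (S - D) := by
    refine isCompactOperator_inv_w2_kernel hz (-(μ ^ 2 / 2)) (S - D) fun f => ?_
    set g : H1 := A12 (resolventA22 hz (ContinuousLinearMap.adjoint A12 f)) with hg
    have hSD : (S - D) f = A11 γ f - (z : ℂ) • f - (μ : ℂ) • (μ : ℂ) • g - D f := by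
      have h : S f = A11 γ f - algebraMap ℂ (H1 →L[ℂ] H1) z f - (μ : ℂ) •
          A12 (resolventA22 hz ((μ : ℂ) • ContinuousLinearMap.adjoint A12 f)) := rfl
      rw [_root_.sub_apply, h, map_smul, map_smul, Algebra.algebraMap_eq_smul_one]
      rfl
    rw [hSD]
    filter_upwards [Lp.coeFn_sub (A11 γ f - (z : ℂ) • f - (μ : ℂ) • (μ : ℂ) • g) (D f),
      Lp.coeFn_sub (A11 γ f - (z : ℂ) • f) ((μ : ℂ) • (μ : ℂ) • g),
      Lp.coeFn_sub (A11 γ f) ((z : ℂ) • f), Lp.coeFn_smul (z : ℂ) f,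
      Lp.coeFn_smul (μ : ℂ) ((μ : ℂ) • g), Lp.coeFn_smul (μ : ℂ) g,
      coeFn_mulOp torusMeasure (w1 γ) (measurable_w1 γ) (bounded_w1 γ) f,
      coeFn_mulOp torusMeasure (fredholm γ μ z) (continuous_fredholm γ μ hz).measurable
        (bounded_fredholm γ μ hz) f,
      coeFn_A12_resolvent_adjoint hz f] with k e1 e2 e3 e4 e5 e6 e7 e8 e9
    have e7' : A11 γ f k = (w1 γ k : ℂ) * f k := e7
    rw [e1, Pi.sub_apply, e2, Pi.sub_apply, e3, Pi.sub_apply, e4, e5, Pi.smul_apply, Pi.smul_apply,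
      e6, Pi.smul_apply, e7', e8, e9]
    have e10 : ∫ s, ((-(μ ^ 2 / 2) * (w2 k s - z)⁻¹ : ℝ) : ℂ) * f s ∂torusMeasure =
        -(μ ^ 2 / 2 : ℂ) * ∫ s, (((w2 k s - z)⁻¹ : ℝ) : ℂ) * f s ∂torusMeasure := by
      rw [← integral_const_mul]
      refine integral_congr_ae (Eventually.of_forall fun s => ?_)
      push_cast
      ring
    rw [e10, fredholm]
    simp only [smul_eq_mul]
    push_cast
    ring
  have := seqProper_add_isCompactOperator_iff (R := D) hcomp
  rwa [add_sub_cancel] at this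

theorem mem_essentialSpectrum_opA_iff (γ μ : ℝ) {z : ℝ} (hz : z ∉ Icc (0 : ℝ) 18) :
    (z : ℂ) ∈ essentialSpectrum (opA γ μ) ↔ ∃ k ∈ torus, fredholm γ μ z k = 0 := by
  rw [mem_essentialSpectrum_iff (isSelfAdjoint_opA γ μ), seqProper_opA_sub_iff γ μ hz,
    exists_torus_fredholm_iff]
  push Not
  rfl

theorem friedrichs_schur (γ μ : ℝ) (k : Fin 3 → ℝ) {z : ℝ} (hz : z ∉ Icc (0 : ℝ) 18) (c : ℂ) :
    (A00 γ k - algebraMap ℂ (ℂ →L[ℂ] ℂ) z) c - (((μ / √2 : ℝ) : ℂ) • A01) (resolventA11At k hz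
      ((((μ / √2 : ℝ) : ℂ) • ContinuousLinearMap.adjoint A01) c)) = (fredholm γ μ z k : ℂ) * c := by
  have h2 : ((√2 : ℝ) : ℂ) ^ 2 = 2 := by
    rw [← Complex.ofReal_pow, Real.sq_sqrt (by norm_num)]
    simp
  have h3 : ((μ : ℂ) / ((√2 : ℝ) : ℂ)) ^ 2 = (μ : ℂ) ^ 2 / 2 := by
    rw [div_pow, h2]
  have h4 : (A00 γ k - algebraMap ℂ (ℂ →L[ℂ] ℂ) z) c = ((w1 γ k : ℂ) - z) * c := by
    simp [A00, Algebra.algebraMap_eq_smul_one, sub_mul]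
  rw [h4]
  simp only [_root_.smul_apply, map_smul, A01_resolvent_adjoint, smul_eq_mul, fredholm]
  push_cast
  linear_combination (-(∫ s, (w2 k s - z)⁻¹ ∂torusMeasure : ℝ) * c : ℂ) * h3

/-- The Schur complement acts on `ℂ` as the scalar `fredholm γ μ z k`. It is always sequentially
proper, so off the band any spectral point is discrete and only the existence of a null vector
matters. -/
theorem mem_discreteSpectrum_friedrichs_iff (γ μ : ℝ) (k : Fin 3 → ℝ) {z : ℝ}
    (hz : z ∉ Icc (0 : ℝ) 18) :
    (z : ℂ) ∈ discreteSpectrum (friedrichs γ μ k) ↔ fredholm γ μ z k = 0 := by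
  have hsub : friedrichs γ μ k - algebraMap ℂ _ (z : ℂ) = blockMatrix
      (A00 γ k - algebraMap ℂ _ (z : ℂ)) (((μ / √2 : ℝ) : ℂ) • A01)
      (((μ / √2 : ℝ) : ℂ) • ContinuousLinearMap.adjoint A01) (A11At k - algebraMap ℂ _ (z : ℂ)) :=
    blockMatrix_sub_algebraMap _ _ _ _ _
  constructor
  · rintro ⟨-, -, hev, -⟩
    obtain ⟨x, hxev⟩ := hev.exists_hasEigenvector
    have hx0 := hxev.2
    have hx : x ∈ Module.End.eigenspace (friedrichs γ μ k : _ →ₗ[ℂ] _) (z : ℂ) :=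
      Module.End.mem_eigenspace_iff.2 hxev.apply_eq_smul
    rw [eigenspace_eq_ker] at hx
    have hx' : (friedrichs γ μ k - algebraMap ℂ _ (z : ℂ)) x = 0 := hx
    rw [hsub, blockMatrix_apply'] at hx'
    have hfst := congrArg WithLp.fst hx'
    have hsnd := congrArg WithLp.snd hx'
    simp only [WithLp.toLp_fst, WithLp.toLp_snd, WithLp.zero_fst, WithLp.zero_snd] at hfst hsnd
    have hs : x.snd = -resolventA11At k hz
        ((((μ / √2 : ℝ) : ℂ) • ContinuousLinearMap.adjoint A01) x.fst) := by
      have h1 := congrArg (resolventA11At k hz) hsnd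
      rw [map_add, resolvent_A11At_sub, map_zero] at h1
      exact eq_neg_of_add_eq_zero_right h1
    rw [hs, map_neg, ← sub_eq_add_neg, friedrichs_schur γ μ k hz] at hfst
    rcases mul_eq_zero.1 hfst with h | h
    · exact_mod_cast h
    · exfalso
      refine hx0 ((WithLp.equiv 2 (ℂ × H1)).injective (Prod.ext h ?_))
      have : x.snd = 0 := by rw [hs, h, map_zero, map_zero, neg_zero]
      exact this
  · intro h
    have hT := isSelfAdjoint_friedrichs γ μ k
    refine mem_discreteSpectrum_of_seqProper hT ?_ ?_
    · rw [hsub, seqProper_blockMatrix_iff (A11At_sub_resolvent k hz) (resolvent_A11At_sub k hz)]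
      exact seqProper_of_finiteDimensional _
    · by_contra hns
      have hu := notMem_spectrum_iff.1 hns
      rw [ContinuousLinearMap.isUnit_iff_bijective] at hu
      -- This vector solves the second row, and its first row is the scalar `fredholm γ μ z k`, here
      -- zero.
      set x : WithLp 2 (ℂ × H1) := WithLp.toLp 2 (1, -resolventA11At k hz
        ((((μ / √2 : ℝ) : ℂ) • ContinuousLinearMap.adjoint A01) 1)) with hx
      have hx0 : x = 0 := by
        refine hu.1 ?_
        rw [map_zero, hsub, hx, blockMatrix_apply, map_neg, map_neg, ← sub_eq_add_neg,
          friedrichs_schur γ μ k hz, A11At_sub_resolvent, h, add_neg_cancel]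
        simp
      have : (1 : ℂ) = 0 := congrArg WithLp.fst hx0
      exact one_ne_zero this

theorem ofReal_re_of_mem_lambdaSet {γ μ : ℝ} {z : ℂ} (h : z ∈ lambdaSet γ μ) :
    ((z.re : ℝ) : ℂ) = z := by
  obtain ⟨k, -, hk⟩ := mem_iUnion₂.1 h
  exact ofReal_re_of_mem_spectrum (isSelfAdjoint_friedrichs γ μ k) hk.1

theorem mem_lambdaSet_iff (γ μ : ℝ) {z : ℝ} (hz : z ∉ Icc (0 : ℝ) 18) :
    (z : ℂ) ∈ lambdaSet γ μ ↔ ∃ k ∈ torus, fredholm γ μ z k = 0 := by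
  simp only [lambdaSet, mem_iUnion, exists_prop, mem_discreteSpectrum_friedrichs_iff γ μ _ hz]

/-! ### The two-particle band -/

/-- For symmetric normalized indicators of small sets the annihilation operator is small. -/
theorem norm_A12_sq_le {f : H2} {U V : Set (Fin 3 → ℝ)} {c : ℝ} (hc : 0 < c)
    (hf : f.1 =ᵐ[torusMeasure.prod torusMeasure]
      ((U ×ˢ V) ∪ (V ×ˢ U)).indicator fun _ => (c : ℂ)) :
    ‖A12 f‖ ^ 2 ≤ c * (torusMeasure.real U + torusMeasure.real V) * l1Norm f.1 := by
  have hval : ∀ᵐ k ∂torusMeasure, A12 f k = ∫ s, f.1 (k, s) ∂torusMeasure :=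
    coeFn_partialIntegral torusMeasure torusMeasure f.1
  have hbound : ∀ᵐ k ∂torusMeasure,
      ‖A12 f k‖ ≤ c * (torusMeasure.real U + torusMeasure.real V) := by
    filter_upwards [hval, Measure.ae_ae_of_ae_prod hf] with k h1 h2
    rw [h1, integral_congr_ae h2]
    -- Each section of the support lies in `U ∪ V`. Its measurable hull has the same measure and
    -- avoids assuming that `U` and `V` are measurable.
    have h3 : ∫ s, ((U ×ˢ V) ∪ (V ×ˢ U)).indicator (fun _ => (c : ℂ)) (k, s) ∂torusMeasure =
        ∫ s in toMeasurable torusMeasure (U ∪ V), ((U ×ˢ V) ∪ (V ×ˢ U)).indicator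
          (fun _ => (c : ℂ)) (k, s) ∂torusMeasure := by
      refine (setIntegral_eq_integral_of_forall_compl_eq_zero fun s hs => ?_).symm
      refine indicator_of_notMem (fun hmem => hs (subset_toMeasurable _ _ ?_)) _
      rcases hmem with hmem | hmem
      · exact Or.inr hmem.2
      · exact Or.inl hmem.2
    rw [h3]
    have h4 := norm_setIntegral_le_of_norm_le_const (μ := torusMeasure) (C := c)
      (s := toMeasurable torusMeasure (U ∪ V)) (f := fun s => ((U ×ˢ V) ∪ (V ×ˢ U)).indicator
          (fun _ => (c : ℂ)) (k, s)) (measure_lt_top _ _) (fun s _ => by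
        refine (norm_indicator_le_norm_self _ _).trans ?_
        rw [Complex.norm_real, Real.norm_eq_abs, abs_of_pos hc])
    refine h4.trans ?_
    gcongr
    rw [measureReal_def, measure_toMeasurable]
    exact measureReal_union_le U V
  refine (norm_sq_le_mul_l1Norm hbound).trans ?_
  gcongr
  have hint := (integrable_coeFn f.1).norm
  rw [l1Norm, l1Norm, integral_prod _ hint]
  refine integral_mono_ae (integrable_coeFn (A12 f)).norm hint.integral_prod_left ?_
  filter_upwards [hval] with k hk
  rw [hk]
  exact norm_integral_le_integral_norm _

theorem norm_A22_sub_le {z δ : ℝ} {f : H2} {E : Set ((Fin 3 → ℝ) × (Fin 3 → ℝ))}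
    (hf : ∀ᵐ x ∂(torusMeasure.prod torusMeasure), x ∉ E → f.1 x = 0)
    (hE : ∀ x ∈ E, |w2 x.1 x.2 - z| ≤ δ) :
    ‖(A22 - algebraMap ℂ (H2 →L[ℂ] H2) z) f‖ ≤ δ * ‖f‖ := by
  rw [Submodule.coe_norm, Submodule.coe_norm, coe_A22_sub]
  exact norm_mulOp_le (w := fun x : (Fin 3 → ℝ) × (Fin 3 → ℝ) => w2 x.1 x.2 - z) _ _ hf hE

theorem exists_approx_band {z : ℝ} (hz : z ∈ Icc (0 : ℝ) 18) {ε : ℝ} (hε : 0 < ε) :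
    ∃ f : H2, ‖f‖ = 1 ∧ ‖(A22 - algebraMap ℂ (H2 →L[ℂ] H2) z) f‖ ≤ ε ∧ ‖A12 f‖ ≤ ε ∧
      l1Norm f.1 ≤ ε := by
  -- The diagonal values `w2 t t` already run from `0` at the origin to `18` at the corner.
  obtain ⟨t, ht⟩ : ∃ t : Fin 3 → ℝ, t ∈ closedCube ∧ w2 t t = z := by
    have hcont : ContinuousOn (fun t => w2 t t) closedCube :=
      (continuous_w2.comp (continuous_id.prodMk continuous_id)).continuousOn
    have h0 : w2 0 0 = 0 := by simp [w2, eps]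
    have h18 : w2 (fun _ => Real.pi) (fun _ => Real.pi) = 18 := by
      have : (1 / 2 : ℝ) • ((fun _ : Fin 3 => Real.pi) + fun _ => Real.pi) = fun _ => Real.pi := by
        funext i
        simp only [Pi.smul_apply, Pi.add_apply, smul_eq_mul]
        ring
      unfold w2
      rw [this, eps_pi]
      norm_num
    have := isPreconnected_closedCube.intermediate_value
      (torus_subset_closedCube zero_mem_torus) (torus_subset_closedCube pi_mem_torus) hcont
    rw [h0, h18] at this
    exact this hz
  obtain ⟨htc, htz⟩ := ht
  have hW : IsOpen {x : (Fin 3 → ℝ) × (Fin 3 → ℝ) | |w2 x.1 x.2 - z| < ε} :=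
    isOpen_lt (continuous_w2.sub continuous_const).abs continuous_const
  obtain ⟨U₀, V₀, hU₀, hV₀, htU, htV, hUV⟩ := isOpen_prod_iff.1 hW t t (by simpa [htz] using hε)
  have hUV' : ∀ k ∈ U₀, ∀ p ∈ V₀, |w2 k p - z| < ε := by
    intro k hk p hp
    have h := hUV (mk_mem_prod hk hp)
    exact h
  obtain ⟨U, hU, hUU, hUpos, hUε⟩ := exists_small_subset hU₀ htc htU
    -- The bound by `1` gives `|E| ≤ 2|U||V| ≤ ε²`, which controls the `L¹` norm; the bound by `ε² /
    -- 2` gives `|U| + |V| ≤ ε²`, which controls `A12`.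
    (ε := min 1 (ε ^ 2 / 2)) (by positivity)
  obtain ⟨V, hV, hVV, hVpos, hVε⟩ := exists_small_subset hV₀ htc htV
    (ε := min 1 (ε ^ 2 / 2)) (by positivity)
  set E : Set ((Fin 3 → ℝ) × (Fin 3 → ℝ)) := (U ×ˢ V) ∪ (V ×ˢ U) with hE
  have hEm : MeasurableSet E := (hU.prod hV).union (hV.prod hU)
  have hUVm : (torusMeasure.prod torusMeasure).real (U ×ˢ V) =
    torusMeasure.real U * torusMeasure.real V := measureReal_prod_prod U V
  have hEpos : 0 < (torusMeasure.prod torusMeasure).real E := by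
    refine lt_of_lt_of_le ?_ (measureReal_mono subset_union_left)
    rw [hUVm]
    positivity
  have hEle : (torusMeasure.prod torusMeasure).real E ≤ ε ^ 2 := by
    refine (measureReal_union_le _ _).trans ?_
    rw [hUVm, measureReal_prod_prod]
    have h1 : torusMeasure.real U ≤ 1 := hUε.trans (min_le_left _ _)
    have h2 : torusMeasure.real V ≤ ε ^ 2 / 2 := hVε.trans (min_le_right _ _)
    nlinarith
  obtain ⟨f, c, hc, hcE, hf1, hfE, hfl⟩ :=
    exists_normalized_indicator (ν := torusMeasure.prod torusMeasure) hEm hEpos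
  have hsymm : f ∈ symmetricSubspace := by
    change ∀ᵐ x ∂(torusMeasure.prod torusMeasure), f (x.2, x.1) = f x
    filter_upwards [hfE, (Measure.measurePreserving_swap
      (μ := torusMeasure) (ν := torusMeasure)).quasiMeasurePreserving.ae hfE] with x h1 h2
    have h2' : f (x.2, x.1) = E.indicator (fun _ => (c : ℂ)) (x.2, x.1) := h2
    rw [h1, h2']
    have hmem : (x.2, x.1) ∈ E ↔ x ∈ E := by
      simp only [hE, mem_union, mem_prod]
      tauto
    by_cases hx : x ∈ E
    · rw [indicator_of_mem hx, indicator_of_mem (hmem.2 hx)]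
    · rw [indicator_of_notMem hx, indicator_of_notMem (fun h => hx (hmem.1 h))]
  have hEw : ∀ x ∈ E, |w2 x.1 x.2 - z| ≤ ε := by
    rintro ⟨k, p⟩ (hx | hx)
    · exact (hUV' k (hUU hx.1) p (hVV hx.2)).le
    · rw [w2_comm]
      exact (hUV' p (hUU hx.2) k (hVV hx.1)).le
  have hfsupp : ∀ᵐ x ∂(torusMeasure.prod torusMeasure), x ∉ E → f x = 0 := by
    filter_upwards [hfE] with x hx hxE
    rw [hx, indicator_of_notMem hxE]
  have hl0 := l1Norm_nonneg f
  refine ⟨⟨f, hsymm⟩, hf1, ?_, ?_, ?_⟩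
  · have h := norm_A22_sub_le (f := ⟨f, hsymm⟩) hfsupp hEw
    have hf1' : ‖(⟨f, hsymm⟩ : H2)‖ = 1 := hf1
    rwa [hf1', mul_one] at h
  · refine le_of_sq_le_sq ((norm_A12_sq_le (f := ⟨f, hsymm⟩) hc hfE).trans ?_) hε.le
    -- Both `c ^ 2 * |E| = 1` and `l1Norm f ^ 2 = |E|` hold, so only `|U| + |V|` remains in the
    -- bound.
    have hcl : c * l1Norm f = 1 := by
      have h1 : (c * l1Norm f) ^ 2 = 1 := by rw [mul_pow, hfl, hcE]
      exact (pow_eq_one_iff_of_nonneg (by positivity) two_ne_zero).1 h1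
    have h2 : torusMeasure.real U ≤ ε ^ 2 / 2 := hUε.trans (min_le_right _ _)
    have h3 : torusMeasure.real V ≤ ε ^ 2 / 2 := hVε.trans (min_le_right _ _)
    calc c * (torusMeasure.real U + torusMeasure.real V) * l1Norm f
        = (torusMeasure.real U + torusMeasure.real V) * (c * l1Norm f) := by ring
      _ ≤ ε ^ 2 := by rw [hcl]; linarith
  · exact le_of_sq_le_sq (hfl.trans_le hEle) hε.le

theorem mem_essentialSpectrum_of_mem_band (γ μ : ℝ) {z : ℝ} (hz : z ∈ Icc (0 : ℝ) 18) :
    (z : ℂ) ∈ essentialSpectrum (opA γ μ) := by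
  rw [mem_essentialSpectrum_iff (isSelfAdjoint_opA γ μ), opA, blockMatrix_sub_algebraMap]
  refine not_seqProper_of_approx (fun x => ‖x.fst‖ + l1Norm x.snd.1) ?_ (fun x hx => ?_)
    fun ε hε => ?_
  · have h1 : Continuous fun x : WithLp 2 (H1 × H2) => x.fst :=
      continuous_fst.comp (WithLp.prodContinuousLinearEquiv 2 ℂ H1 H2).continuous
    have h2 : Continuous fun x : WithLp 2 (H1 × H2) => x.snd :=
      continuous_snd.comp (WithLp.prodContinuousLinearEquiv 2 ℂ H1 H2).continuous
    exact h1.norm.add (continuous_l1Norm.comp (continuous_subtype_val.comp h2))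
  · have h1 := norm_nonneg x.fst
    have h2 := l1Norm_nonneg x.snd.1
    have h3 : x.fst = 0 := norm_eq_zero.1 (by linarith)
    have h4 : x.snd = 0 := Subtype.ext (eq_zero_of_l1Norm_eq_zero (by linarith))
    exact (WithLp.equiv 2 (H1 × H2)).injective (Prod.ext h3 h4)
  -- The singular sequence consists of the vectors `(0, f)`. The image is at most `|μ| * ‖A12 f‖`
  -- plus `‖(A22 - z) f‖`, which sum to at most `ε` for this tolerance.
  · obtain ⟨f, hf1, hf2, hf3, hf4⟩ := exists_approx_band hz (ε := ε / (|μ| + 1)) (by positivity)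
    have hε' : ε / (|μ| + 1) ≤ ε := div_le_self hε.le (by linarith [abs_nonneg μ])
    refine ⟨WithLp.toLp 2 (0, f), ?_, ?_, ?_⟩
    · rw [← hf1]
      have h1 := WithLp.prod_norm_sq_eq_of_L2 (WithLp.toLp 2 ((0 : H1), f))
      simp only [WithLp.toLp_fst, WithLp.toLp_snd, norm_zero] at h1
      refine (pow_left_inj₀ (norm_nonneg _) (norm_nonneg _) two_ne_zero).1 ?_
      linarith
    · rw [blockMatrix_apply, map_zero, map_zero, zero_add, zero_add]
      refine (norm_toLp_le _ _).trans ?_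
      rw [_root_.smul_apply, norm_smul, Complex.norm_real, Real.norm_eq_abs]
      calc |μ| * ‖A12 f‖ + ‖(A22 - algebraMap ℂ (H2 →L[ℂ] H2) z) f‖
          ≤ |μ| * (ε / (|μ| + 1)) + ε / (|μ| + 1) := by gcongr
        _ = ε := by field_simp
    · simp only [WithLp.toLp_fst, WithLp.toLp_snd, norm_zero, zero_add]
      rw [abs_of_nonneg (l1Norm_nonneg _)]
      exact hf4.trans hε'

/-! ### Location of the essential spectrum -/

/-- Points of `lambdaSet` inside the band are absorbed by it, so the equation for the discrete
spectrum is needed only off the band. -/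
theorem sigmaSet_eq (γ μ : ℝ) : sigmaSet γ μ = Complex.ofReal ''
    (Icc 0 18 ∪ {z | z ∉ Icc (0 : ℝ) 18 ∧ ∃ k ∈ closedCube, fredholm γ μ z k = 0}) := by
  rw [sigmaSet, wMin, wMax, zero_isLeast_w2Values.csInf_eq, eighteen_isGreatest_w2Values.csSup_eq]
  ext z
  constructor
  · rintro (⟨x, hx, rfl⟩ | hz)
    · exact ⟨x, Or.inl hx, rfl⟩
    · have hre := ofReal_re_of_mem_lambdaSet hz
      by_cases hx : z.re ∈ Icc (0 : ℝ) 18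
      · exact ⟨z.re, Or.inl hx, hre⟩
      · rw [← hre, mem_lambdaSet_iff γ μ hx, exists_torus_fredholm_iff] at hz
        exact ⟨z.re, Or.inr ⟨hx, hz⟩, hre⟩
  · rintro ⟨x, hx | ⟨hx, hk⟩, rfl⟩
    · exact Or.inl ⟨x, hx, rfl⟩
    · right
      rw [mem_lambdaSet_iff γ μ hx, exists_torus_fredholm_iff]
      exact hk

theorem essentialSpectrum_opA (γ μ : ℝ) : essentialSpectrum (opA γ μ) = sigmaSet γ μ := by
  rw [sigmaSet_eq]
  ext z
  constructor
  · intro hz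
    have hre := ofReal_re_of_mem_spectrum (isSelfAdjoint_opA γ μ) hz.1
    by_cases hx : z.re ∈ Icc (0 : ℝ) 18
    · exact ⟨z.re, Or.inl hx, hre⟩
    · rw [← hre, mem_essentialSpectrum_opA_iff γ μ hx, exists_torus_fredholm_iff] at hz
      exact ⟨z.re, Or.inr ⟨hx, hz⟩, hre⟩
  · rintro ⟨x, hx | ⟨hx, hk⟩, rfl⟩
    · exact mem_essentialSpectrum_of_mem_band γ μ hx
    · rw [mem_essentialSpectrum_opA_iff γ μ hx, exists_torus_fredholm_iff]
      exact hk

/-! ### Zero sets of monotone families and unions of intervals -/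

section Zeros

variable {X : Type*} [TopologicalSpace X] {K : Set X} {F : X → ℝ → ℝ} {c : ℝ}

/-- The zeros below `c` of a family of functions that is continuous and strictly decreasing there
form an interval. -/
theorem zeros_eq_interval (hK : IsCompact K) (hKc : IsPreconnected K)
    (hF : ContinuousOn (fun x : X × ℝ => F x.1 x.2) (univ ×ˢ Iio c))
    (hmono : ∀ k z z', z < z' → z' < c → F k z' + (z' - z) ≤ F k z)
    (hne : ∀ z < c, ∃ k ∈ K, F k z ≠ 0) :
    {z | z < c ∧ ∃ k ∈ K, F k z = 0} = ∅ ∨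
      (∃ a b, a < b ∧ b < c ∧ {z | z < c ∧ ∃ k ∈ K, F k z = 0} = Icc a b) ∨
      ∃ a < c, {z | z < c ∧ ∃ k ∈ K, F k z = 0} = Ico a c := by
  set Z : Set ℝ := {z | z < c ∧ ∃ k ∈ K, F k z = 0} with hZ
  have hlt : ∀ k z z', z < z' → z' < c → F k z' < F k z := fun k z z' h h' => by
    linarith [hmono k z z' h h']
  have hFk : ∀ z < c, ContinuousOn (fun k => F k z) K := fun z hz =>
    hF.comp (f := fun k => (k, z)) (by fun_prop) fun k _ => ⟨mem_univ _, hz⟩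
  have hFz : ∀ k, ∀ z < c, ContinuousAt (F k) z := fun k z hz =>
    (hF.comp (f := fun y => (k, y)) (s := Iio c) (by fun_prop)
      fun y hy => ⟨mem_univ _, hy⟩).continuousAt (Iio_mem_nhds hz)
  have hivt : ∀ z < c, ∀ k₁ ∈ K, ∀ k₂ ∈ K, F k₁ z ≤ 0 → 0 ≤ F k₂ z → z ∈ Z := by
    intro z hz k₁ hk₁ k₂ hk₂ h₁ h₂
    obtain ⟨k, hk, hk0⟩ := hKc.intermediate_value hk₁ hk₂ (hFk z hz) ⟨h₁, h₂⟩
    exact ⟨hz, k, hk, hk0⟩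
  -- At an intermediate `z` the function with a zero at `z₁` has become nonpositive and the one with
  -- a zero at `z₂` is still nonnegative, so some `k` between them vanishes at `z`.
  have hconv : ∀ z₁ ∈ Z, ∀ z₂ ∈ Z, ∀ z, z₁ ≤ z → z ≤ z₂ → z ∈ Z := by
    rintro z₁ h₁ z₂ h₂ z hz₁ hz₂
    rcases hz₁.eq_or_lt with rfl | hz₁
    · exact h₁
    rcases hz₂.eq_or_lt with rfl | hz₂
    · exact h₂
    obtain ⟨-, k₁, hk₁, h₁⟩ := h₁
    obtain ⟨h₂c, k₂, hk₂, h₂⟩ := h₂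
    have hz : z < c := hz₂.trans h₂c
    refine hivt z hz k₁ hk₁ k₂ hk₂ ?_ ?_
    · rw [← h₁]
      exact (hlt k₁ z₁ z hz₁ hz).le
    · rw [← h₂]
      exact (hlt k₂ z z₂ hz₂ h₂c).le
  -- With `|F k (c - 1)| ≤ C` on `K` and slope at most `-1`, the values are positive as soon as `z`
  -- lies more than `C` below `c - 1`.
  obtain ⟨B, hB⟩ : ∃ B, ∀ z ∈ Z, B ≤ z := by
    obtain ⟨C, hC⟩ := hK.exists_bound_of_continuousOn (hFk (c - 1) (by linarith))
    refine ⟨c - 1 - max C 0 - 1, fun z hz => ?_⟩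
    by_contra! hcon
    obtain ⟨-, k, hk, hk0⟩ := hz
    have h1 := hmono k z (c - 1) (by linarith [le_max_right C 0]) (by linarith)
    have h2 := (abs_le.1 (hC k hk)).1
    linarith [le_max_left C 0]
  -- This part of `Z` is the projection of a compact set of zeros in `K ×ˢ Icc B b`.
  have hcompact : ∀ b < c, IsCompact (Z ∩ Icc B b) := by
    intro b hb
    have hcl : IsCompact {x : X × ℝ | x ∈ K ×ˢ Icc B b ∧ F x.1 x.2 = 0} := by
      have hc : ContinuousOn (fun x : X × ℝ => F x.1 x.2) (K ×ˢ Icc B b) :=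
        hF.mono (prod_mono (subset_univ _) fun y hy => hy.2.trans_lt hb)
      have hcp : IsCompact (K ×ˢ Icc B b) := hK.prod isCompact_Icc
      have : CompactSpace (K ×ˢ Icc B b : Set (X × ℝ)) := isCompact_iff_compactSpace.1 hcp
      have h1 : IsClosed {x : (K ×ˢ Icc B b : Set (X × ℝ)) | F x.1.1 x.1.2 = 0} :=
        isClosed_eq hc.domRestrict continuous_const
      convert h1.isCompact.image continuous_subtype_val using 1
      ext x
      simp only [mem_ofPred_eq, mem_image, Subtype.exists, exists_and_left, exists_prop]
      constructor
      · rintro ⟨h2, h3⟩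
        exact ⟨x, h3, h2, rfl⟩
      · rintro ⟨y, h3, h2, rfl⟩
        exact ⟨h2, h3⟩
    convert hcl.image continuous_snd using 1
    ext z
    constructor
    · rintro ⟨⟨-, k, hk, hk0⟩, hz⟩
      exact ⟨(k, z), ⟨⟨hk, hz⟩, hk0⟩, rfl⟩
    · rintro ⟨⟨k, z⟩, ⟨⟨hk, hz⟩, hk0⟩, rfl⟩
      exact ⟨⟨hz.2.trans_lt hb, k, hk, hk0⟩, hz⟩
  rcases Z.eq_empty_or_nonempty with hempty | ⟨z₀, hz₀⟩
  · exact Or.inl hempty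
  right
  obtain ⟨a, ⟨haZ, ha⟩, hamin⟩ := (hcompact z₀ hz₀.1).exists_isLeast ⟨z₀, hz₀, hB z₀ hz₀, le_rfl⟩
  have hleast : ∀ z ∈ Z, a ≤ z := by
    intro z hz
    rcases le_total z z₀ with h | h
    · exact hamin ⟨hz, hB z hz, h⟩
    · exact ha.2.trans h
  by_cases hbdd : ∃ b < c, ∀ z ∈ Z, z ≤ b
  · left
    obtain ⟨b', hb'c, hb'⟩ := hbdd
    obtain ⟨b, ⟨hbZ, -⟩, hbmax⟩ := (hcompact b' hb'c).exists_isGreatest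
      ⟨z₀, hz₀, hB z₀ hz₀, hb' z₀ hz₀⟩
    have hgreatest : ∀ z ∈ Z, z ≤ b := fun z hz => hbmax ⟨hz, hB z hz, hb' z hz⟩
    refine ⟨a, b, lt_of_le_of_ne (hleast b hbZ) fun hab => ?_, hbZ.1,
      Subset.antisymm (fun z hz => ⟨hleast z hz, hgreatest z hz⟩)
        fun z hz => hconv a haZ b hbZ z hz.1 hz.2⟩
    -- A single point is impossible: at `a` some `k₀` gives zero and some `k` does not. A small
    -- move, to the left if `F k a < 0` and to the right if `F k a > 0`, keeps the sign at `k` and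
    -- gives `k₀` the opposite one, so another zero appears.
    subst hab
    obtain ⟨hac, k₀, hk₀, hk₀0⟩ := haZ
    obtain ⟨k, hk, hka⟩ := hne a hac
    rcases lt_or_gt_of_ne hka with h | h
    · have hev : ∀ᶠ z in 𝓝 a, F k z < 0 := (hFz k a hac).eventually_lt_const h
      obtain ⟨l, hl, hlF⟩ := exists_Ioc_subset_of_mem_nhds hev ⟨a - 1, by linarith⟩
      have h1 : F k ((l + a) / 2) < 0 := hlF ⟨by linarith, by linarith⟩
      have h2 := hlt k₀ ((l + a) / 2) a (by linarith) hac
      have h3 := hleast _ (hivt ((l + a) / 2) (by linarith) k hk k₀ hk₀ h1.le (by linarith))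
      linarith
    · have hev : ∀ᶠ z in 𝓝 a, 0 < F k z := (hFz k a hac).eventually_const_lt h
      obtain ⟨u, hu, huF⟩ := exists_Ico_subset_of_mem_nhds
        (hev.and (Iio_mem_nhds hac)) ⟨a + 1, by linarith⟩
      have h1 := huF (show (a + u) / 2 ∈ Ico a u from ⟨by linarith, by linarith⟩)
      have h2 := hlt k₀ a ((a + u) / 2) (by linarith) h1.2
      have h3 := hgreatest _ (hivt ((a + u) / 2) h1.2 k₀ hk₀ k hk (by linarith) h1.1.le)
      linarith
  · right
    push Not at hbdd
    refine ⟨a, haZ.1, Subset.antisymm (fun z hz => ⟨hleast z hz, hz.1⟩) fun z hz => ?_⟩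
    obtain ⟨b, hbZ, hzb⟩ := hbdd z hz.2
    exact hconv a haZ b hbZ z hz.1 hzb.le

end Zeros

/-- A set of reals is a union of `n` closed intervals of positive length. -/
def IsUnionIcc (S : Set ℝ) (n : ℕ) : Prop :=
  ∃ a b : Fin n → ℝ, (∀ i, a i < b i) ∧ S = ⋃ i, Icc (a i) (b i)

theorem isUnionIcc_empty : IsUnionIcc ∅ 0 := ⟨fun _ => 0, fun _ => 1, fun i => i.elim0, by simp⟩

theorem isUnionIcc_Icc {a b : ℝ} (h : a < b) : IsUnionIcc (Icc a b) 1 :=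
  ⟨fun _ => a, fun _ => b, fun _ => h, (iUnion_const _).symm⟩

theorem IsUnionIcc.union {S T : Set ℝ} {n m : ℕ} (hS : IsUnionIcc S n) (hT : IsUnionIcc T m) :
    IsUnionIcc (S ∪ T) (n + m) := by
  obtain ⟨a, b, hab, rfl⟩ := hS
  obtain ⟨a', b', hab', rfl⟩ := hT
  refine ⟨Fin.append a a', Fin.append b b', fun i => ?_, ?_⟩
  · refine Fin.addCases (fun j => ?_) (fun j => ?_) i
    · simpa using hab j
    · simpa using hab' j
  · ext x
    simp only [mem_union, mem_iUnion]
    constructor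
    · rintro (⟨i, hi⟩ | ⟨i, hi⟩)
      · exact ⟨Fin.castAdd m i, by simpa using hi⟩
      · exact ⟨Fin.natAdd n i, by simpa using hi⟩
    · rintro ⟨i, hi⟩
      revert hi
      refine Fin.addCases (fun j hj => ?_) (fun j hj => ?_) i
      · exact Or.inl ⟨j, by simpa using hj⟩
      · exact Or.inr ⟨j, by simpa using hj⟩

/-! ### The zero set of the Fredholm determinant -/

theorem exists_fredholm_ne_zero (γ μ : ℝ) {z : ℝ} (hz : z ∉ Icc (0 : ℝ) 18) :
    ∃ k ∈ closedCube, fredholm γ μ z k ≠ 0 := by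
  by_contra! h
  have := fredholm_zero_lt_pi γ μ hz
  rw [h _ (torus_subset_closedCube zero_mem_torus),
    h _ (torus_subset_closedCube pi_mem_torus)] at this
  exact lt_irrefl _ this

/-- A zero interval `[a, 0)` that reaches the band merely enlarges it, and the left end `p` records
this; a detached one is counted in `S`. -/
theorem exists_left_decomposition (γ μ : ℝ) : ∃ p ≤ 0, ∃ n ≤ 1, ∃ S, IsUnionIcc S n ∧
    {z : ℝ | z < 0 ∧ ∃ k ∈ closedCube, fredholm γ μ z k = 0} ∪ Icc 0 18 = S ∪ Icc p 18 := by
  have hsub : ∀ z : ℝ, z < 0 → z ∉ Icc (0 : ℝ) 18 := fun z hz h => by linarith [h.1]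
  rcases zeros_eq_interval (F := fun k z => fredholm γ μ z k) (c := 0) isCompact_closedCube
      isPreconnected_closedCube
      ((continuousOn_fredholm γ μ).mono (prod_mono Subset.rfl fun z hz => hsub z hz))
      (fun k z z' h h' => fredholm_add_sub_le γ μ h (Or.inl h') k)
      (fun z hz => exists_fredholm_ne_zero γ μ (hsub z hz)) with h | ⟨a, b, hab, -, h⟩ | ⟨a, ha, h⟩
  · exact ⟨0, le_rfl, 0, by norm_num, ∅, isUnionIcc_empty, by rw [h]⟩
  · exact ⟨0, le_rfl, 1, le_rfl, _, isUnionIcc_Icc hab, by rw [h]⟩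
  · refine ⟨a, ha.le, 0, by norm_num, ∅, isUnionIcc_empty, ?_⟩
    rw [h, Ico_union_Icc_eq_Icc ha.le (by norm_num), empty_union]

theorem exists_right_decomposition (γ μ : ℝ) : ∃ q ≥ 18, ∃ n ≤ 1, ∃ S, IsUnionIcc S n ∧
    Icc 0 18 ∪ {z : ℝ | 18 < z ∧ ∃ k ∈ closedCube, fredholm γ μ z k = 0} = S ∪ Icc 0 q := by
  have hsub : ∀ z : ℝ, z < -18 → -z ∉ Icc (0 : ℝ) 18 := fun z hz h => by linarith [h.2]
  have hcont : ContinuousOn (fun x : (Fin 3 → ℝ) × ℝ => -fredholm γ μ (-x.2) x.1)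
      (univ ×ˢ Iio (-18)) :=
    ((continuousOn_fredholm γ μ).comp (f := fun x : (Fin 3 → ℝ) × ℝ => (x.1, -x.2)) (by fun_prop)
      fun x hx => ⟨mem_univ _, hsub x.2 hx.2⟩).neg
  -- The substitution `z ↦ -z` reverses the monotonicity, and the sign of the function is changed to
  -- restore it, so that `zeros_eq_interval` applies above the band too.
  have hneg : {z : ℝ | 18 < z ∧ ∃ k ∈ closedCube, fredholm γ μ z k = 0} =
      -{z : ℝ | z < -18 ∧ ∃ k ∈ closedCube, -fredholm γ μ (-z) k = 0} := by
    ext z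
    simp only [mem_ofPred_eq, Set.mem_neg, neg_neg, neg_lt_neg_iff, neg_eq_zero]
  rw [hneg]
  rcases zeros_eq_interval (F := fun k z => -fredholm γ μ (-z) k) (c := -18) isCompact_closedCube
      isPreconnected_closedCube hcont
      (fun k z z' h h' => by
        have := fredholm_add_sub_le γ μ (neg_lt_neg h) (Or.inr (by linarith)) k
        linarith)
      (fun z hz => by
        simpa using exists_fredholm_ne_zero γ μ (hsub z hz))
    with h | ⟨a, b, hab, -, h⟩ | ⟨a, ha, h⟩
  · exact ⟨18, le_rfl, 0, by norm_num, ∅, isUnionIcc_empty, by rw [h]; simp⟩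
  · refine ⟨18, le_rfl, 1, le_rfl, _, isUnionIcc_Icc (neg_lt_neg hab), ?_⟩
    rw [h, union_comm]
    congr 1
    ext z
    simp only [Set.mem_neg, mem_Icc]
    constructor <;> rintro ⟨h1, h2⟩ <;> constructor <;> linarith
  · refine ⟨-a, by linarith, 0, by norm_num, ∅, isUnionIcc_empty, ?_⟩
    have : -Ico a (-18) = Ioc 18 (-a) := by
      ext z
      simp only [Set.mem_neg, mem_Ico, mem_Ioc]
      constructor <;> rintro ⟨h1, h2⟩ <;> constructor <;> linarith
    rw [h, this, Icc_union_Ioc_eq_Icc (by norm_num) (by linarith), empty_union]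

theorem exists_isUnionIcc (γ μ : ℝ) : ∃ n ≤ 3, IsUnionIcc
    (Icc 0 18 ∪ {z | z ∉ Icc (0 : ℝ) 18 ∧ ∃ k ∈ closedCube, fredholm γ μ z k = 0}) n := by
  obtain ⟨p, hp, n, hn, S, hS, hSe⟩ := exists_left_decomposition γ μ
  obtain ⟨q, hq, m, hm, T, hT, hTe⟩ := exists_right_decomposition γ μ
  refine ⟨n + m + 1, by omega, ?_⟩
  have hsplit : Icc 0 18 ∪ {z | z ∉ Icc (0 : ℝ) 18 ∧ ∃ k ∈ closedCube, fredholm γ μ z k = 0} =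
      ({z : ℝ | z < 0 ∧ ∃ k ∈ closedCube, fredholm γ μ z k = 0} ∪ Icc 0 18) ∪
        (Icc 0 18 ∪ {z : ℝ | 18 < z ∧ ∃ k ∈ closedCube, fredholm γ μ z k = 0}) := by
    ext z
    simp only [mem_union, mem_ofPred_eq, mem_Icc, not_and_or, not_le]
    generalize (∃ k ∈ closedCube, fredholm γ μ z k = 0) = P
    tauto
  -- The enlarged bands from the two sides overlap in `[0, 18]` and count as one interval, besides
  -- at most one detached interval on each side.
  have hmid : Icc p 18 ∪ Icc 0 q = Icc p q := by
    rw [Icc_union_Icc' (by norm_num) (by linarith), min_eq_left hp, max_eq_right hq]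
  rw [hsplit, hSe, hTe, union_union_union_comm, hmid]
  exact (hS.union hT).union (isUnionIcc_Icc (by linarith))

end LatticeModel

end

theorem theorem2 (γ μ : ℝ) (hμ : 0 < μ) :
    LatticeModel.essentialSpectrum (LatticeModel.opA γ μ) = LatticeModel.sigmaSet γ μ ∧
    ∃ n : ℕ, n ≤ 3 ∧ ∃ a b : Fin n → ℝ, (∀ i, a i < b i) ∧
      LatticeModel.sigmaSet γ μ = ⋃ i, Complex.ofReal '' Set.Icc (a i) (b i) := by
  refine ⟨LatticeModel.essentialSpectrum_opA γ μ, ?_⟩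
  obtain ⟨n, hn, a, b, hab, h⟩ := LatticeModel.exists_isUnionIcc γ μ
  exact ⟨n, hn, a, b, hab, by rw [LatticeModel.sigmaSet_eq, h, Set.image_iUnion]⟩
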